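/- Let $\mathcal C\subset\mathbb R^d$ be a bounded convex (Borel) set with nonempty interior, contained in the closed ball of radius $R_0$ about $0$. Let $\mathcal P_2(\mathcal C)$ be the set of Borel probability measures carried by $\mathcal C$ (with finite second moment). Let $U:\mathcal C\to\mathbb R$ be differentiable on $\mathcal C$ with $\|\nabla U(x)-\nabla U(y)\|_2\le C_1\|x-y\|_2$ for all $x,y\in\mathcal C$, where $C_1\ge 0$ and where gradients at boundary points belonging to $\mathcal C$ are taken relative to $\mathcal C$. For $\epsilon>0$ put $\varphi_\epsilon(x)=\exp(-\|x\|_2^2/(2\epsilon))$ and $$F^\epsilon[\rho]=\int_{\mathcal C}\Big(U(x)+\ln\big((\varphi_\epsilon*\rho)(x)\big)\Big)\,d\rho(x),\qquad \rho\in\mathcal P_2(\mathcal C).$$ A first variation of $F^\epsilon$ at $\rho$ is a function $V$ on $\mathcal C$, integrable against every measure in $\mathcal P_2(\mathcal C)$, such that $\int V\,d(\mu-\rho)=\frac{d}{dt}F^\epsilon[(1-t)\rho+t\mu]\big|_{t=0^+}$ for all $\mu\in\mathcal P_2(\mathcal C)$; it is denoted $\frac{\delta F^\epsilon}{\delta\rho}\big|_\rho$.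 Let $\nu$ be an atomless Borel probability measure on a Polish space, let $L^2(\nu;\mathcal C)$ be the set of $X\in L^2(\nu;\mathbb R^d)$ with $X\in\mathcal C$ $\nu$-a.e., and let $\tilde F^\epsilon(X)=F^\epsilon[X_\#\nu]$ be the lifting of $F^\epsilon$. Then: 1. For every $\rho\in\mathcal P_2(\mathcal C)$ a first variation of $F^\epsilon$ at $\rho$ exists, and every first variation at $\rho$ is differentiable on $\mathcal C$. 2. For every $X\in L^2(\nu;\mathcal C)$ the lifting $\tilde F^\epsilon$ is Fréchet differentiable at $X$ relative to $L^2(\nu;\mathcal C)$, with a unique gradient $G[X]\in L^2(\nu;\mathbb R^d)$, and for every first variation of $F^\epsilon$ at $X_\#\nu$, $G[X](z)=\nabla\frac{\delta F^\epsilon}{\delta\rho}\big|_{X_\#\nu}(X(z))$ for $\nu$-a.e. $z$. 3. For all $X,Y\in L^2(\nu;\mathcal C)$, $$\int\|G[X](z)-G[Y](z)\|_2^2\,d\nu(z)\le\Big(C_1+\frac3\epsilon e^{8R_0^2/\epsilon}\Big)^2\int\|X(z)-Y(z)\|_2^2\,d\nu(z).$$ -/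

import Mathlib

open MeasureTheory

noncomputable section

/-- Euclidean space `ℝ^d` with its `ℓ²` norm. -/
abbrev Euc (d : ℕ) : Type := EuclideanSpace ℝ (Fin d)

/-- `𝒫₂(C)`: Borel probability measures on `ℝ^d` carried by `C`, with finite second moment. -/
def P2 {d : ℕ} (C : Set (Euc d)) : Set (Measure (Euc d)) :=
  {ρ | IsProbabilityMeasure ρ ∧ (∀ᵐ x ∂ρ, x ∈ C) ∧ Integrable (fun x => ‖x‖ ^ 2) ρ}

/-- The unnormalized Gaussian kernel `φ_ε(x) = exp(-‖x‖² / (2ε))`. -/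
def gaussKernel {d : ℕ} (ε : ℝ) (x : Euc d) : ℝ :=
  Real.exp (-(‖x‖ ^ 2 / (2 * ε)))

/-- The convolution `(φ_ε * ρ)(x) = ∫ φ_ε(x - z) dρ(z)`. -/
def gaussConv {d : ℕ} (ε : ℝ) (ρ : Measure (Euc d)) (x : Euc d) : ℝ :=
  ∫ z, gaussKernel ε (x - z) ∂ρ

/-- The regularized Kullback-Leibler functional
`F^ε[ρ] = ∫_C (U(x) + ln((φ_ε * ρ)(x))) dρ(x)`, for `ρ ∈ 𝒫₂(C)`. -/
def regKL {d : ℕ} (C : Set (Euc d)) (U : Euc d → ℝ) (ε : ℝ) (ρ : Measure (Euc d)) : ℝ :=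
  ∫ x in C, (U x + Real.log (gaussConv ε ρ x)) ∂ρ

/-- The mixture `(1 - t) ρ + t μ` for `t ∈ [0, 1]`. -/
def mixture {d : ℕ} (ρ μ : Measure (Euc d)) (t : ℝ) : Measure (Euc d) :=
  ENNReal.ofReal (1 - t) • ρ + ENNReal.ofReal t • μ

/-- `V` is a first variation at `ρ` of the real-valued functional `F` on `𝒫₂(C)`:
for all `μ ∈ 𝒫₂(C)`, `∫ V d(μ - ρ) = d/dt F[(1 - t) ρ + t μ]` at `t = 0`. The derivative is
one-sided because the mixture is a probability measure for `t ∈ [0, 1]` only. Only the values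
of `V` on `C` matter. -/
def IsFirstVariation {d : ℕ} (C : Set (Euc d)) (F : Measure (Euc d) → ℝ)
    (ρ : Measure (Euc d)) (V : Euc d → ℝ) : Prop :=
  Integrable V ρ ∧ ∀ μ ∈ P2 C, Integrable V μ ∧
    HasDerivWithinAt (fun t : ℝ => F (mixture ρ μ t)) (∫ x, V x ∂μ - ∫ x, V x ∂ρ)
      (Set.Icc 0 1) 0

/-- `∇U` exists on `C` and is `C₁`-Lipschitz there. At points of `C` on its boundary the
gradient is taken relative to `C`. -/
structure HasLipschitzGradientOn {d : ℕ} (C : Set (Euc d)) (U : Euc d → ℝ) (C₁ : ℝ) :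
    Prop where
  differentiableOn : DifferentiableOn ℝ U C
  lipschitz : ∀ x ∈ C, ∀ y ∈ C,
    ‖gradientWithin U C x - gradientWithin U C y‖ ≤ C₁ * ‖x - y‖

/-- `L²(ν; C)`, as a subset of the Hilbert space `L²(ν; ℝ^d)`. -/
def L2On {d : ℕ} {Z : Type*} [MeasurableSpace Z] (ν : Measure Z) (C : Set (Euc d)) :
    Set (Lp (Euc d) 2 ν) :=
  {X | ∀ᵐ z ∂ν, X z ∈ C}

/-- The law `X_# ν` of `X ∈ L²(ν; ℝ^d)`. -/
def law {d : ℕ} {Z : Type*} [MeasurableSpace Z] (ν : Measure Z) (X : Lp (Euc d) 2 ν) :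
    Measure (Euc d) :=
  ν.map (fun z => X z)

/-- The lifting `F̃(X) = F[X_# ν]`. -/
def lifting {d : ℕ} {Z : Type*} [MeasurableSpace Z] (ν : Measure Z)
    (F : Measure (Euc d) → ℝ) (X : Lp (Euc d) 2 ν) : ℝ :=
  F (law ν X)

/-- The functional gradient `G[X] = DF̃(X) ∈ L²(ν; ℝ^d)`: the Fréchet gradient, in the Hilbert
space `L²(ν; ℝ^d)` and relative to `L²(ν; C)`, of the lifting of `F`. -/
def liftedGradient {d : ℕ} {Z : Type*} [MeasurableSpace Z] (ν : Measure Z)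
    (C : Set (Euc d)) (F : Measure (Euc d) → ℝ) (X : Lp (Euc d) 2 ν) : Lp (Euc d) 2 ν :=
  gradientWithin (lifting ν F) (L2On ν C) X

end

/-! Write `m = exp(-2R²/ε)`. Two points of `C` are at distance at most `2R`, so `φ_ε * ρ` lies
between `m` and `1` on `C`, and the logarithm is smooth there with controlled constants. Formally,
the first variation is `V = U + ln(φ_ε * ρ) + ∫ φ_ε(· - z) / (φ_ε * ρ)(z) dρ(z)`. The last term
comes from varying `ρ` inside the logarithm, followed by Fubini and the evenness of the kernel
(`integral_gaussConv_div`). Dirac masses are admissible test measures, so any other first variation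
differs from `V` by a constant on `C` and has the same gradient.

Every differentiability claim is proved through a quadratic bound on the first-order remainder. The
sources are the Lipschitz gradient of `U`, the global `1/ε`-Lipschitz bound for `∇φ_ε`
(`norm_gaussGrad_sub_le`), and the remainder of the logarithm on `[m, ∞)`. Such bounds survive
integration. For the lifting, the expansion first produces a pairing with `H z - H w`, where `H = Y
- X`. The oddness of `∇φ_ε` turns it into a pairing with `H z` alone (`integral_inner_entropyGrad`),
and the gradient that appears is `∇V ∘ X`. It is unique because tangent directions to `L²(ν; C)`
span a dense subspace, even where that set has empty interior (`uniqueDiffWithinAt_L2On`).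

For the Lipschitz constant, the kernel sees only differences of positions, so the entropy part of
`G[Y] - G[X]` is bounded by the mean deviations `D z = ∫ ‖H z - H w‖ dν(w)` and by `∫ D`
(`norm_entropyGrad_map_sub_le`). By the variance identity both have squared `L²` norm at most `2
‖H‖²`. A weighted Cauchy–Schwarz inequality (`integral_sq_le_of_le_mean_deviation`) then costs a
factor `3/2 ≥ √2`, and elementary exponential bounds give the stated constant. -/

/-! ### Quadratic remainders and gradients relative to a set -/

section Remainder

variable {F : Type*} [NormedAddCommGroup F] [InnerProductSpace ℝ F] [CompleteSpace F]

/-- A quadratic bound on the first-order remainder gives differentiability. -/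
theorem HasFDerivWithinAt.of_sq_bound {E G : Type*} [NormedAddCommGroup E] [NormedSpace ℝ E]
    [NormedAddCommGroup G] [NormedSpace ℝ G] {f : E → G} {f' : E →L[ℝ] G} {s : Set E} {x : E}
    (M : ℝ) (h : ∀ y ∈ s, ‖f y - f x - f' (y - x)‖ ≤ M * ‖y - x‖ ^ 2) :
    HasFDerivWithinAt f f' s x := by
  refine HasFDerivWithinAt.of_isLittleO ?_
  have h1 : (fun y => f y - f x - f' (y - x)) =O[nhdsWithin x s] fun y => ‖y - x‖ ^ 2 := by
    refine Asymptotics.IsBigO.of_bound M ?_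
    filter_upwards [self_mem_nhdsWithin] with y hy
    simpa using h y hy
  refine h1.trans_isLittleO ?_
  have h2 : (fun y => y - x) =o[nhdsWithin x s] fun _ => (1 : ℝ) := by
    rw [Asymptotics.isLittleO_one_iff]
    have : Filter.Tendsto (fun y => y - x) (nhds x) (nhds (x - x)) :=
      (continuous_id.sub continuous_const).tendsto x
    rw [sub_self] at this
    exact this.mono_left nhdsWithin_le_nhds
  have h3 := h2.norm_left.mul_isBigO (Asymptotics.isBigO_refl (fun y => ‖y - x‖) (nhdsWithin x s))
  simp only [one_mul] at h3
  simpa [pow_two] using h3.norm_right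

theorem HasGradientWithinAt.of_sq_bound {f : F → ℝ} {g x : F} {s : Set F}
    (M : ℝ) (h : ∀ y ∈ s, |f y - f x - inner ℝ g (y - x)| ≤ M * ‖y - x‖ ^ 2) :
    HasGradientWithinAt f g s x := by
  rw [hasGradientWithinAt_iff_hasFDerivWithinAt]
  exact HasFDerivWithinAt.of_sq_bound M (by simpa using h)

theorem HasGradientWithinAt.add {f₁ f₂ : F → ℝ} {g₁ g₂ x : F} {s : Set F}
    (h₁ : HasGradientWithinAt f₁ g₁ s x) (h₂ : HasGradientWithinAt f₂ g₂ s x) :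
    HasGradientWithinAt (fun y => f₁ y + f₂ y) (g₁ + g₂) s x := by
  rw [hasGradientWithinAt_iff_hasFDerivWithinAt] at *
  rw [map_add]
  exact h₁.fun_add h₂

/-- Descent lemma: a Lipschitz gradient on a convex set gives a quadratic remainder. -/
theorem abs_sub_sub_inner_le_of_lipschitz_gradient {f : F → ℝ} {g : F → F} {s : Set F} {M : ℝ}
    (hM : 0 ≤ M) (hs : Convex ℝ s) (hf : ∀ x ∈ s, HasGradientWithinAt f (g x) s x)
    (hg : ∀ x ∈ s, ∀ y ∈ s, ‖g x - g y‖ ≤ M * ‖x - y‖) {x y : F} (hx : x ∈ s) (hy : y ∈ s) :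
    |f y - f x - inner ℝ (g x) (y - x)| ≤ M * ‖y - x‖ ^ 2 := by
  have hsub : segment ℝ x y ⊆ s := hs.segment_subset hx hy
  -- Mean value inequality on the segment for `u ↦ f u - ⟪g x, u⟫`, whose gradient `g u - g x` is at
  -- most `M ‖y - x‖` there. This gives the constant `M` rather than the sharp `M / 2`, which
  -- suffices.
  have h1 : ∀ u ∈ segment ℝ x y, HasFDerivWithinAt (fun u => f u - inner ℝ (g x) u)
      (InnerProductSpace.toDual ℝ F (g u) - innerSL ℝ (g x)) (segment ℝ x y) u := fun u hu =>
    ((hasGradientWithinAt_iff_hasFDerivWithinAt.1 (hf u (hsub hu))).mono hsub).fun_sub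
      (innerSL ℝ (g x)).hasFDerivWithinAt
  have h2 : ∀ u ∈ segment ℝ x y,
      ‖InnerProductSpace.toDual ℝ F (g u) - innerSL ℝ (g x)‖ ≤ M * ‖y - x‖ := by
    intro u hu
    have : InnerProductSpace.toDual ℝ F (g u) - innerSL ℝ (g x)
        = InnerProductSpace.toDual ℝ F (g u - g x) := by
      ext v; simp
    rw [this, LinearIsometryEquiv.norm_map]
    refine (hg u (hsub hu) x hx).trans ?_
    gcongr
    exact norm_sub_le_of_mem_segment hu
  have := (convex_segment x y).norm_image_sub_le_of_norm_hasFDerivWithin_le h1 h2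
    (left_mem_segment ℝ x y) (right_mem_segment ℝ x y)
  rw [Real.norm_eq_abs] at this
  rw [inner_sub_right]
  calc _ = |f y - inner ℝ (g x) y - (f x - inner ℝ (g x) x)| := by congr 1; ring
    _ ≤ _ := this.trans_eq (by ring)

end Remainder

/-- Quadratic remainder of the logarithm. -/
theorem Real.abs_log_sub_log_sub_le {m a b : ℝ} (hm : 0 < m) (ha : m ≤ a) (hb : m ≤ b) :
    |Real.log b - Real.log a - a⁻¹ * (b - a)| ≤ (b - a) ^ 2 / m ^ 2 := by
  have ha' := hm.trans_le ha
  have hb' := hm.trans_le hb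
  -- The inequality `log t ≤ t - 1` at `t = b / a` makes the remainder nonpositive; at `t = a / b`
  -- it bounds it below by `-(b - a)² / (a b)`.
  have h1 := Real.log_le_sub_one_of_pos (div_pos hb' ha')
  have h2 := Real.log_le_sub_one_of_pos (div_pos ha' hb')
  rw [Real.log_div hb'.ne' ha'.ne'] at h1
  rw [Real.log_div ha'.ne' hb'.ne'] at h2
  have h3 : (b - a) ^ 2 / (a * b) ≤ (b - a) ^ 2 / m ^ 2 := by
    rw [pow_two m]; gcongr
  have h4 : (b - a) ^ 2 / (a * b) = a / b - 1 + a⁻¹ * (b - a) := by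
    field_simp; ring
  have h5 : a⁻¹ * (b - a) = b / a - 1 := by field_simp
  rw [abs_le]
  constructor
  · linarith
  · have : 0 ≤ (b - a) ^ 2 / m ^ 2 := by positivity
    linarith

/-! ### The Gaussian kernel and its derivatives -/

section Kernel

variable {d : ℕ} {ε : ℝ}

/-- The gradient `-(φ_ε(u) / ε) u` of the Gaussian kernel. -/
noncomputable def gaussGrad (ε : ℝ) (u : Euc d) : Euc d := -(gaussKernel ε u / ε) • u

theorem gaussKernel_pos (u : Euc d) : 0 < gaussKernel ε u := Real.exp_pos _

theorem gaussKernel_le_one (hε : 0 < ε) (u : Euc d) : gaussKernel ε u ≤ 1 := by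
  rw [gaussKernel, Real.exp_le_one_iff, neg_nonpos]
  positivity

theorem gaussKernel_ge (hε : 0 < ε) {r : ℝ} {u : Euc d} (hu : ‖u‖ ≤ r) :
    Real.exp (-(r ^ 2 / (2 * ε))) ≤ gaussKernel ε u := by
  rw [gaussKernel]
  gcongr

theorem gaussKernel_neg (u : Euc d) : gaussKernel ε (-u) = gaussKernel ε u := by
  simp [gaussKernel]

theorem gaussGrad_neg (u : Euc d) : gaussGrad ε (-u) = -gaussGrad ε u := by
  simp [gaussGrad, gaussKernel_neg]

@[fun_prop]
theorem continuous_gaussKernel : Continuous (gaussKernel ε : Euc d → ℝ) := by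
  unfold gaussKernel; fun_prop

@[fun_prop]
theorem continuous_gaussGrad : Continuous (gaussGrad ε : Euc d → Euc d) := by
  unfold gaussGrad; fun_prop

theorem norm_gaussGrad_le (hε : 0 < ε) (u : Euc d) : ‖gaussGrad ε u‖ ≤ ‖u‖ / ε := by
  have h := gaussKernel_le_one hε u
  have h0 := gaussKernel_pos (ε := ε) u
  rw [gaussGrad, norm_smul, norm_neg, Real.norm_of_nonneg (by positivity)]
  calc gaussKernel ε u / ε * ‖u‖ ≤ 1 / ε * ‖u‖ := by gcongr
    _ = _ := by ring

theorem hasFDerivAt_gaussKernel (u : Euc d) :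
    HasFDerivAt (gaussKernel ε) (-(gaussKernel ε u / ε) • innerSL ℝ u) u := by
  have h := ((((hasStrictFDerivAt_norm_sq u).hasFDerivAt).mul_const (2 * ε)⁻¹).fun_neg).exp
  refine (h.congr_fderiv ?_)
  ext v
  simp [gaussKernel, div_eq_mul_inv]
  ring

theorem hasGradientAt_gaussKernel (u : Euc d) :
    HasGradientAt (gaussKernel ε) (gaussGrad ε u) u := by
  rw [hasGradientAt_iff_hasFDerivAt]
  refine (hasFDerivAt_gaussKernel u).congr_fderiv ?_
  ext v
  simp [gaussGrad]

/-- This is `(1 - s)² ≤ exp s`, the scalar inequality behind the Hessian bound of the kernel. The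
cubic Taylor polynomial of `exp` exceeds the left side by `s (s² - 3s + 18) / 6 ≥ 0`. -/
theorem one_add_sq_sub_le_exp {s : ℝ} (hs : 0 ≤ s) : 1 + s ^ 2 - 2 * s ≤ Real.exp s := by
  have h := Real.sum_le_exp_of_nonneg hs 4
  simp [Finset.sum_range_succ, Nat.factorial] at h
  nlinarith [mul_nonneg hs (sq_nonneg (s - 3 / 2))]

/-- With `k = φ_ε(w)` and `s = ‖w‖² / ε`, the Hessian at `w` is `(k/ε)(-I + w ⊗ w / ε)`, with
eigenvalues `-k/ε` and `(k/ε)(s - 1)`. Since `k² = exp(-s)`, both are at most `1/ε` in modulus as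
soon as `(1 - s)² ≤ exp s`. -/
theorem norm_gaussGrad_sub_le (hε : 0 < ε) (u v : Euc d) :
    ‖gaussGrad ε u - gaussGrad ε v‖ ≤ 1 / ε * ‖u - v‖ := by
  have hder : ∀ w ∈ (Set.univ : Set (Euc d)), HasFDerivWithinAt (gaussGrad ε)
      ((-(gaussKernel ε w / ε)) • ContinuousLinearMap.id ℝ (Euc d) +
        ((gaussKernel ε w / ε ^ 2) • innerSL ℝ w).smulRight w) Set.univ w := by
    intro w _
    have h := ((((hasFDerivAt_gaussKernel (ε := ε) w).mul_const ε⁻¹).fun_neg).fun_smul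
      (hasFDerivAt_id w)).hasFDerivWithinAt (s := Set.univ)
    refine h.congr_fderiv ?_
    ext x i
    simp
    ring
  refine Convex.norm_image_sub_le_of_norm_hasFDerivWithin_le hder ?_ convex_univ
    (Set.mem_univ v) (Set.mem_univ u)
  intro w _
  refine ContinuousLinearMap.opNorm_le_bound _ (by positivity) fun h => ?_
  set k := gaussKernel ε w with hk
  have hk0 : 0 < k := gaussKernel_pos w
  have hk1 : k ≤ 1 := gaussKernel_le_one hε w
  set s := ‖w‖ ^ 2 / ε with hs
  have hs0 : 0 ≤ s := by positivity
  have hks : k ^ 2 * Real.exp s = 1 := by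
    rw [hk, gaussKernel, ← Real.exp_nat_mul, ← Real.exp_add, Real.exp_eq_one_iff, hs]
    field_simp; push_cast; ring
  have hw : ‖w‖ ^ 2 = s * ε := by rw [hs]; field_simp
  set p := inner ℝ w h with hp
  have hpp : p ^ 2 ≤ s * ε * ‖h‖ ^ 2 := by
    rw [← hw, ← mul_pow, ← sq_abs]
    gcongr
    exact abs_real_inner_le_norm w h
  have key : ‖h - (p / ε) • w‖ ^ 2 = ‖h‖ ^ 2 + p ^ 2 / ε * (s - 2) := by
    rw [norm_sub_sq_real, inner_smul_right, real_inner_comm, ← hp, norm_smul, mul_pow,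
      hw, Real.norm_eq_abs, sq_abs]
    field_simp; ring
  -- For `s ≤ 2` the second term is nonpositive. For `s ≥ 2` it is largest when `h` is parallel to
  -- `w`, by Cauchy–Schwarz, and the scalar inequality applies.
  have key2 : ‖h‖ ^ 2 + p ^ 2 / ε * (s - 2) ≤ ‖h‖ ^ 2 * Real.exp s := by
    rcases le_total s 2 with h2 | h2
    · have h3 : p ^ 2 / ε * (s - 2) ≤ 0 :=
        mul_nonpos_of_nonneg_of_nonpos (by positivity) (by linarith)
      have := Real.one_le_exp hs0
      nlinarith [sq_nonneg ‖h‖]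
    · have h3 : p ^ 2 / ε ≤ s * ‖h‖ ^ 2 := by
        rw [div_le_iff₀ hε]; linarith
      calc _ ≤ ‖h‖ ^ 2 + s * ‖h‖ ^ 2 * (s - 2) := by
            have := mul_le_mul_of_nonneg_right h3 (by linarith : 0 ≤ s - 2); linarith
        _ = ‖h‖ ^ 2 * (1 + s ^ 2 - 2 * s) := by ring
        _ ≤ _ := by gcongr; exact one_add_sq_sub_le_exp hs0
  have key3 : k * ‖h - (p / ε) • w‖ ≤ ‖h‖ := by
    refine le_of_sq_le_sq ?_ (norm_nonneg _)
    rw [mul_pow, key]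
    calc _ ≤ k ^ 2 * (‖h‖ ^ 2 * Real.exp s) := by gcongr
      _ = ‖h‖ ^ 2 := by linear_combination ‖h‖ ^ 2 * hks
  have e : ((-(k / ε)) • ContinuousLinearMap.id ℝ (Euc d) +
        ((k / ε ^ 2) • innerSL ℝ w).smulRight w) h = (-(k / ε)) • (h - (p / ε) • w) := by
    ext i
    simp [hp]
    field_simp; ring
  rw [e, norm_smul, norm_neg, Real.norm_of_nonneg (by positivity)]
  calc _ = 1 / ε * (k * ‖h - (p / ε) • w‖) := by ring
    _ ≤ _ := by gcongr

theorem abs_gaussKernel_sub_sub_inner_le (hε : 0 < ε) (u v : Euc d) :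
    |gaussKernel ε v - gaussKernel ε u - inner ℝ (gaussGrad ε u) (v - u)|
      ≤ 1 / ε * ‖v - u‖ ^ 2 :=
  abs_sub_sub_inner_le_of_lipschitz_gradient (by positivity) convex_univ
    (fun x _ => hasGradientWithinAt_univ.2 (hasGradientAt_gaussKernel x))
    (fun x _ y _ => norm_gaussGrad_sub_le hε x y) (Set.mem_univ u) (Set.mem_univ v)

theorem abs_gaussKernel_sub_le (hε : 0 < ε) {r : ℝ} {u v : Euc d} (hu : ‖u‖ ≤ r)
    (hv : ‖v‖ ≤ r) : |gaussKernel ε u - gaussKernel ε v| ≤ r / ε * ‖u - v‖ := by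
  refine Convex.norm_image_sub_le_of_norm_hasFDerivWithin_le (s := Metric.closedBall 0 r)
    (f := gaussKernel ε) (f' := fun w => InnerProductSpace.toDual ℝ _ (gaussGrad ε w))
    (fun w _ => (hasGradientAt_gaussKernel w).hasFDerivAt.hasFDerivWithinAt) ?_
    (convex_closedBall 0 r) (by simpa using hv) (by simpa using hu)
  intro w hw
  rw [LinearIsometryEquiv.norm_map]
  refine (norm_gaussGrad_le hε w).trans ?_
  gcongr
  simpa using hw

end Kernel

/-! ### Convolutions with the kernel and the potential -/

section Convolution

variable {d : ℕ} {ε : ℝ}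

/-- The potential `∫ φ_ε(x - z) / (φ_ε * ρ)(z) dρ(z)`. -/
noncomputable def gaussPot (ε : ℝ) (ρ : Measure (Euc d)) (x : Euc d) : ℝ :=
  ∫ z, (gaussConv ε ρ z)⁻¹ * gaussKernel ε (x - z) ∂ρ

/-- The canonical first variation of the regularized Kullback-Leibler functional. -/
noncomputable def klVariation (U : Euc d → ℝ) (ε : ℝ) (ρ : Measure (Euc d)) (x : Euc d) : ℝ :=
  U x + (Real.log (gaussConv ε ρ x) + gaussPot ε ρ x)

/-- The gradient of `ln (φ_ε * ρ) + ∫ φ_ε(· - z) / (φ_ε * ρ)(z) dρ(z)`. -/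
noncomputable def entropyGrad (ε : ℝ) (ρ : Measure (Euc d)) (x : Euc d) : Euc d :=
  (gaussConv ε ρ x)⁻¹ • ∫ z, gaussGrad ε (x - z) ∂ρ +
    ∫ z, (gaussConv ε ρ z)⁻¹ • gaussGrad ε (x - z) ∂ρ

theorem integrable_gaussKernel_sub (hε : 0 < ε) (ρ : Measure (Euc d)) [IsFiniteMeasure ρ]
    (x : Euc d) : Integrable (fun z => gaussKernel ε (x - z)) ρ := by
  refine Integrable.of_bound (by fun_prop) 1 (.of_forall fun z => ?_)
  rw [Real.norm_of_nonneg (gaussKernel_pos _).le]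
  exact gaussKernel_le_one hε _

theorem continuous_gaussConv (hε : 0 < ε) (ρ : Measure (Euc d)) [IsFiniteMeasure ρ] :
    Continuous (gaussConv ε ρ) := by
  refine continuous_of_dominated (bound := fun _ => 1) (fun x => by fun_prop)
    (fun x => .of_forall fun z => ?_) (integrable_const _) (.of_forall fun z => by fun_prop)
  rw [Real.norm_of_nonneg (gaussKernel_pos _).le]
  exact gaussKernel_le_one hε _

theorem gaussConv_le_one (hε : 0 < ε) (ρ : Measure (Euc d)) [IsProbabilityMeasure ρ]
    (x : Euc d) : gaussConv ε ρ x ≤ 1 := by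
  have := integral_mono (integrable_gaussKernel_sub hε ρ x) (integrable_const 1)
    (fun z => gaussKernel_le_one hε (x - z))
  simpa [gaussConv] using this

theorem gaussConv_nonneg (ρ : Measure (Euc d)) (x : Euc d) : 0 ≤ gaussConv ε ρ x :=
  integral_nonneg fun _ => (gaussKernel_pos _).le

theorem gaussConv_pos (hε : 0 < ε) (ρ : Measure (Euc d)) [IsProbabilityMeasure ρ]
    (x : Euc d) : 0 < gaussConv ε ρ x := by
  have := (integral_pos_iff_support_of_nonneg (fun z => (gaussKernel_pos (ε := ε) (x - z)).le)
    (integrable_gaussKernel_sub hε ρ x)).2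
  refine this ?_
  have : Function.support (fun z => gaussKernel ε (x - z)) = Set.univ := by
    ext z; simp [(gaussKernel_pos (ε := ε) (x - z)).ne']
  simp [this]

/-- Points of the ball of radius `R` are at distance at most `2R`, whence the exponent `(2R)² / (2ε)
= 2R² / ε`. This is the constant `m` of all later estimates. -/
theorem gaussConv_ge (hε : 0 < ε) {ρ : Measure (Euc d)} [IsProbabilityMeasure ρ] {R : ℝ}
    (hρ : ∀ᵐ z ∂ρ, ‖z‖ ≤ R) {x : Euc d} (hx : ‖x‖ ≤ R) :
    Real.exp (-(2 * R ^ 2 / ε)) ≤ gaussConv ε ρ x := by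
  have h : ∀ᵐ z ∂ρ, Real.exp (-(2 * R ^ 2 / ε)) ≤ gaussKernel ε (x - z) := by
    filter_upwards [hρ] with z hz
    have := gaussKernel_ge hε (u := x - z) (r := 2 * R)
      ((norm_sub_le x z).trans (by linarith))
    convert this using 3
    ring
  have := integral_mono_ae (integrable_const _) (integrable_gaussKernel_sub hε ρ x) h
  simpa [gaussConv] using this

theorem inv_gaussConv_le (hε : 0 < ε) {ρ : Measure (Euc d)} [IsProbabilityMeasure ρ] {R : ℝ}
    (hρ : ∀ᵐ z ∂ρ, ‖z‖ ≤ R) {x : Euc d} (hx : ‖x‖ ≤ R) :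
    |(gaussConv ε ρ x)⁻¹| ≤ (Real.exp (-(2 * R ^ 2 / ε)))⁻¹ := by
  rw [abs_of_nonneg (inv_nonneg.2 (gaussConv_nonneg ρ x))]
  exact inv_anti₀ (Real.exp_pos _) (gaussConv_ge hε hρ hx)

theorem measurable_inv_gaussConv (hε : 0 < ε) (ρ : Measure (Euc d)) [IsFiniteMeasure ρ] :
    Measurable fun x => (gaussConv ε ρ x)⁻¹ :=
  (continuous_gaussConv hε ρ).measurable.inv

theorem integrable_smul_gaussGrad (hε : 0 < ε) {ρ : Measure (Euc d)} [IsFiniteMeasure ρ]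
    {R B : ℝ} (hρ : ∀ᵐ z ∂ρ, ‖z‖ ≤ R) {c : Euc d → ℝ} (hc : Measurable c)
    (hB : ∀ᵐ z ∂ρ, |c z| ≤ B) (x : Euc d) :
    Integrable (fun z => c z • gaussGrad ε (x - z)) ρ := by
  refine Integrable.of_bound (by fun_prop) (B * ((‖x‖ + R) / ε)) ?_
  filter_upwards [hρ, hB] with z hz hz'
  have : 0 ≤ B := (abs_nonneg _).trans hz'
  rw [norm_smul, Real.norm_eq_abs]
  have h1 : ‖gaussGrad ε (x - z)‖ ≤ (‖x‖ + R) / ε := by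
    refine (norm_gaussGrad_le hε _).trans ?_
    gcongr
    exact (norm_sub_le _ _).trans (by linarith)
  gcongr

theorem integrable_mul_gaussKernel (hε : 0 < ε) {ρ : Measure (Euc d)} [IsFiniteMeasure ρ]
    {B : ℝ} {c : Euc d → ℝ} (hc : Measurable c)
    (hB : ∀ᵐ z ∂ρ, |c z| ≤ B) (x : Euc d) :
    Integrable (fun z => c z * gaussKernel ε (x - z)) ρ := by
  refine Integrable.of_bound (by fun_prop) (B * 1) ?_
  filter_upwards [hB] with z hz'
  have : 0 ≤ B := (abs_nonneg _).trans hz'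
  rw [norm_mul, Real.norm_eq_abs, Real.norm_of_nonneg (gaussKernel_pos _).le]
  have := gaussKernel_le_one hε (x - z)
  have := gaussKernel_pos (ε := ε) (x - z)
  gcongr

/-- The quadratic remainder of the kernel is uniform in its base point, so it can be integrated
against `c z dρ(z)`. The weights `1` and `1 / (φ_ε * ρ)` give the convolution and the potential. -/
theorem hasGradientAt_integral_mul_gaussKernel (hε : 0 < ε) {ρ : Measure (Euc d)}
    [IsFiniteMeasure ρ] {R B : ℝ} (hρ : ∀ᵐ z ∂ρ, ‖z‖ ≤ R) {c : Euc d → ℝ} (hc : Measurable c)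
    (hB : ∀ᵐ z ∂ρ, |c z| ≤ B) (x : Euc d) :
    HasGradientAt (fun x => ∫ z, c z * gaussKernel ε (x - z) ∂ρ)
      (∫ z, c z • gaussGrad ε (x - z) ∂ρ) x := by
  rw [← hasGradientWithinAt_univ]
  refine HasGradientWithinAt.of_sq_bound (B * (1 / ε) * ρ.real Set.univ) fun y _ => ?_
  have hi := integrable_smul_gaussGrad hε hρ hc hB x
  have e1 : inner ℝ (∫ z, c z • gaussGrad ε (x - z) ∂ρ) (y - x)
      = ∫ z, c z * inner ℝ (gaussGrad ε (x - z)) (y - x) ∂ρ := by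
    rw [real_inner_comm, ← integral_inner hi]
    refine integral_congr_ae (.of_forall fun z => ?_)
    simp only [inner_smul_right, real_inner_comm]
  have hi2 : Integrable (fun z => c z * inner ℝ (gaussGrad ε (x - z)) (y - x)) ρ := by
    refine (hi.inner_const (𝕜 := ℝ) (y - x)).congr (.of_forall fun z => ?_)
    simp only [inner_smul_left]; rfl
  have hk := integrable_mul_gaussKernel hε hc hB
  rw [e1, ← integral_sub (hk y) (hk x), ← integral_sub ((hk y).sub' (hk x)) hi2]
  have := norm_integral_le_of_norm_le_const (μ := ρ) (C := B * (1 / ε * ‖y - x‖ ^ 2))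
    (f := fun z => c z * gaussKernel ε (y - z) - c z * gaussKernel ε (x - z) -
      c z * inner ℝ (gaussGrad ε (x - z)) (y - x)) ?_
  · rw [Real.norm_eq_abs] at this
    exact this.trans_eq (by ring)
  · filter_upwards [hB] with z hz
    have h := abs_gaussKernel_sub_sub_inner_le hε (x - z) (y - z)
    rw [sub_sub_sub_cancel_right] at h
    have : 0 ≤ B := (abs_nonneg _).trans hz
    rw [← mul_sub, ← mul_sub, norm_mul, Real.norm_eq_abs, Real.norm_eq_abs]
    gcongr

theorem hasGradientAt_gaussConv (hε : 0 < ε) {ρ : Measure (Euc d)}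
    [IsFiniteMeasure ρ] {R : ℝ} (hρ : ∀ᵐ z ∂ρ, ‖z‖ ≤ R) (x : Euc d) :
    HasGradientAt (gaussConv ε ρ) (∫ z, gaussGrad ε (x - z) ∂ρ) x := by
  have := hasGradientAt_integral_mul_gaussKernel hε hρ (c := fun _ => 1) measurable_const
    (B := 1) (by simp) x
  simpa [← gaussConv.eq_1] using this

theorem hasGradientAt_gaussPot (hε : 0 < ε) {ρ : Measure (Euc d)}
    [IsProbabilityMeasure ρ] {R : ℝ} (hρ : ∀ᵐ z ∂ρ, ‖z‖ ≤ R) (x : Euc d) :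
    HasGradientAt (gaussPot ε ρ) (∫ z, (gaussConv ε ρ z)⁻¹ • gaussGrad ε (x - z) ∂ρ) x :=
  hasGradientAt_integral_mul_gaussKernel hε hρ (measurable_inv_gaussConv hε ρ)
    (hρ.mono fun _ hz => inv_gaussConv_le hε hρ hz) x

theorem hasGradientAt_log_gaussConv_add_gaussPot (hε : 0 < ε) {ρ : Measure (Euc d)}
    [IsProbabilityMeasure ρ] {R : ℝ} (hρ : ∀ᵐ z ∂ρ, ‖z‖ ≤ R) (x : Euc d) :
    HasGradientAt (fun x => Real.log (gaussConv ε ρ x) + gaussPot ε ρ x)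
      (entropyGrad ε ρ x) x := by
  have h1 := (hasGradientAt_gaussConv hε hρ x).hasFDerivAt.log (gaussConv_pos hε ρ x).ne'
  have h2 := (hasGradientAt_gaussPot hε hρ x).hasFDerivAt
  rw [hasGradientAt_iff_hasFDerivAt, entropyGrad, map_add]
  refine (h1.fun_add h2).congr_fderiv ?_
  simp

theorem continuous_gaussPot (hε : 0 < ε) {ρ : Measure (Euc d)}
    [IsProbabilityMeasure ρ] {R : ℝ} (hρ : ∀ᵐ z ∂ρ, ‖z‖ ≤ R) : Continuous (gaussPot ε ρ) :=
  continuous_iff_continuousAt.2 fun x => (hasGradientAt_gaussPot hε hρ x).continuousAt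

/-- Fubini and the evenness of the kernel. This identity turns the variation of `ρ` inside the
logarithm into the integral of a function against `μ`. -/
theorem integral_gaussConv_div (hε : 0 < ε) {ρ μ : Measure (Euc d)} [IsProbabilityMeasure ρ]
    [IsProbabilityMeasure μ] {R : ℝ} (hρ : ∀ᵐ z ∂ρ, ‖z‖ ≤ R) :
    ∫ x, (gaussConv ε ρ x)⁻¹ * gaussConv ε μ x ∂ρ = ∫ z, gaussPot ε ρ z ∂μ := by
  have h1 : ∀ x, (gaussConv ε ρ x)⁻¹ * gaussConv ε μ x
      = ∫ z, (gaussConv ε ρ x)⁻¹ * gaussKernel ε (z - x) ∂μ := by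
    intro x
    rw [integral_const_mul]
    congr 1
    refine integral_congr_ae (.of_forall fun z => ?_)
    simp only
    rw [← gaussKernel_neg, neg_sub]
  simp only [h1, gaussPot]
  refine integral_integral_swap ?_
  have hm := measurable_inv_gaussConv hε ρ
  have hm2 : Measurable fun p : Euc d × Euc d => (gaussConv ε ρ p.1)⁻¹ :=
    hm.comp measurable_fst
  refine Integrable.of_bound (C := (Real.exp (-(2 * R ^ 2 / ε)))⁻¹ * 1) ?_ ?_
  · refine (hm2.mul ?_).aestronglyMeasurable
    exact Continuous.measurable (by fun_prop)
  · have : ∀ᵐ p ∂(ρ.prod μ), ‖p.1‖ ≤ R := Measure.quasiMeasurePreserving_fst.ae hρ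
    filter_upwards [this] with p hp
    simp only [Function.uncurry]
    rw [norm_mul, Real.norm_eq_abs, Real.norm_of_nonneg (gaussKernel_pos _).le]
    have := gaussKernel_le_one hε (p.2 - p.1)
    have := gaussKernel_pos (ε := ε) (p.2 - p.1)
    have := inv_gaussConv_le hε hρ hp
    gcongr

end Convolution

/-! ### First variations of the functional on measures -/

section FirstVariation

variable {d : ℕ} {ε : ℝ} {C : Set (Euc d)} {U : Euc d → ℝ} {C₁ R : ℝ}

theorem ae_norm_le_of_mem_P2 (hR : C ⊆ Metric.closedBall 0 R) {ρ : Measure (Euc d)}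
    (hρ : ∀ᵐ x ∂ρ, x ∈ C) : ∀ᵐ x ∂ρ, ‖x‖ ≤ R :=
  hρ.mono fun x hx => by simpa using hR hx

theorem HasLipschitzGradientOn.hasGradientWithinAt (hU : HasLipschitzGradientOn C U C₁)
    {x : Euc d} (hx : x ∈ C) : HasGradientWithinAt U (gradientWithin U C x) C x :=
  (hU.differentiableOn x hx).hasGradientWithinAt

theorem HasLipschitzGradientOn.abs_sub_sub_inner_le (hU : HasLipschitzGradientOn C U C₁)
    (hC₁ : 0 ≤ C₁) (hC : Convex ℝ C) {x y : Euc d} (hx : x ∈ C) (hy : y ∈ C) :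
    |U y - U x - inner ℝ (gradientWithin U C x) (y - x)| ≤ C₁ * ‖y - x‖ ^ 2 :=
  abs_sub_sub_inner_le_of_lipschitz_gradient hC₁ hC (fun _ h => hU.hasGradientWithinAt h)
    hU.lipschitz hx hy

theorem HasLipschitzGradientOn.exists_abs_le (hU : HasLipschitzGradientOn C U C₁)
    (hC₁ : 0 ≤ C₁) (hC : Convex ℝ C) (hR : C ⊆ Metric.closedBall 0 R) :
    ∃ B, ∀ x ∈ C, |U x| ≤ B := by
  rcases C.eq_empty_or_nonempty with rfl | ⟨x, hx⟩
  · exact ⟨0, by simp⟩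
  refine ⟨|U x| + ‖gradientWithin U C x‖ * (2 * R) + C₁ * (2 * R) ^ 2, fun y hy => ?_⟩
  have h1 := hU.abs_sub_sub_inner_le hC₁ hC hx hy
  have hx' : ‖x‖ ≤ R := by simpa using hR hx
  have hy' : ‖y‖ ≤ R := by simpa using hR hy
  have h2 : ‖y - x‖ ≤ 2 * R := (norm_sub_le _ _).trans (by linarith)
  have h3 : |inner ℝ (gradientWithin U C x) (y - x)| ≤ ‖gradientWithin U C x‖ * (2 * R) :=
    (abs_real_inner_le_norm _ _).trans (by gcongr)
  have h4 : C₁ * ‖y - x‖ ^ 2 ≤ C₁ * (2 * R) ^ 2 := by gcongr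
  have h5 := abs_le.1 h1
  have h6 := abs_le.1 h3
  have h7 := neg_abs_le (U x)
  have h8 := le_abs_self (U x)
  rw [abs_le]
  constructor <;> linarith

theorem HasLipschitzGradientOn.exists_norm_gradient_le (hU : HasLipschitzGradientOn C U C₁)
    (hC₁ : 0 ≤ C₁) (hR : C ⊆ Metric.closedBall 0 R) :
    ∃ B, ∀ x ∈ C, ‖gradientWithin U C x‖ ≤ B := by
  rcases C.eq_empty_or_nonempty with rfl | ⟨x, hx⟩
  · exact ⟨0, by simp⟩
  refine ⟨‖gradientWithin U C x‖ + C₁ * (2 * R), fun y hy => ?_⟩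
  have hx' : ‖x‖ ≤ R := by simpa using hR hx
  have hy' : ‖y‖ ≤ R := by simpa using hR hy
  have h2 : ‖y - x‖ ≤ 2 * R := (norm_sub_le _ _).trans (by linarith)
  have h1 := hU.lipschitz y hy x hx
  have h3 := norm_le_norm_add_norm_sub' (gradientWithin U C y) (gradientWithin U C x)
  have h4 : C₁ * ‖y - x‖ ≤ C₁ * (2 * R) := by gcongr
  linarith

theorem HasLipschitzGradientOn.integrable (hU : HasLipschitzGradientOn C U C₁)
    (hC₁ : 0 ≤ C₁) (hC : Convex ℝ C) (hCm : MeasurableSet C) (hR : C ⊆ Metric.closedBall 0 R)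
    {ρ : Measure (Euc d)} [IsFiniteMeasure ρ] (hρ : ∀ᵐ x ∂ρ, x ∈ C) : Integrable U ρ := by
  obtain ⟨B, hB⟩ := hU.exists_abs_le hC₁ hC hR
  refine Integrable.of_bound ?_ B (hρ.mono fun x hx => hB x hx)
  rw [← Measure.restrict_eq_self_of_ae_mem hρ]
  exact hU.differentiableOn.continuousOn.aestronglyMeasurable hCm

theorem integrable_log_gaussConv (hε : 0 < ε) {ρ μ : Measure (Euc d)} [IsProbabilityMeasure ρ]
    [IsFiniteMeasure μ] (hρ : ∀ᵐ x ∂ρ, ‖x‖ ≤ R) (hμ : ∀ᵐ x ∂μ, ‖x‖ ≤ R) :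
    Integrable (fun x => Real.log (gaussConv ε ρ x)) μ := by
  refine Integrable.of_bound (continuous_gaussConv hε ρ).measurable.log.aestronglyMeasurable
    (2 * R ^ 2 / ε) (hμ.mono fun x hx => ?_)
  have h1 := gaussConv_ge hε hρ hx
  have h2 := Real.log_le_log (Real.exp_pos _) h1
  have h3 := Real.log_nonpos (gaussConv_nonneg ρ x) (gaussConv_le_one hε ρ x)
  rw [Real.log_exp] at h2
  rw [Real.norm_of_nonpos h3]
  linarith

theorem integrable_gaussPot (hε : 0 < ε) {ρ μ : Measure (Euc d)} [IsProbabilityMeasure ρ]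
    [IsFiniteMeasure μ] (hρ : ∀ᵐ x ∂ρ, ‖x‖ ≤ R) : Integrable (gaussPot ε ρ) μ := by
  refine Integrable.of_bound (continuous_gaussPot hε hρ).aestronglyMeasurable
    ((Real.exp (-(2 * R ^ 2 / ε)))⁻¹ * 1 * ρ.real Set.univ) (.of_forall fun x => ?_)
  refine norm_integral_le_of_norm_le_const (hρ.mono fun z hz => ?_)
  rw [norm_mul, Real.norm_eq_abs, Real.norm_of_nonneg (gaussKernel_pos _).le]
  have := gaussKernel_le_one hε (x - z)
  have := gaussKernel_pos (ε := ε) (x - z)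
  have := inv_gaussConv_le hε hρ hz
  gcongr

theorem integrable_klVariation (hU : HasLipschitzGradientOn C U C₁)
    (hC₁ : 0 ≤ C₁) (hC : Convex ℝ C) (hCm : MeasurableSet C) (hR : C ⊆ Metric.closedBall 0 R)
    (hε : 0 < ε) {ρ μ : Measure (Euc d)} [IsProbabilityMeasure ρ] [IsFiniteMeasure μ]
    (hρ : ∀ᵐ x ∂ρ, x ∈ C) (hμ : ∀ᵐ x ∂μ, x ∈ C) : Integrable (klVariation U ε ρ) μ :=
  (hU.integrable hC₁ hC hCm hR hμ).add
    ((integrable_log_gaussConv hε (ae_norm_le_of_mem_P2 hR hρ) (ae_norm_le_of_mem_P2 hR hμ)).add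
      (integrable_gaussPot hε (ae_norm_le_of_mem_P2 hR hρ)))

theorem integral_mixture {ρ μ : Measure (Euc d)} {t : ℝ} (ht : t ∈ Set.Icc (0 : ℝ) 1)
    {f : Euc d → ℝ} (hρ : Integrable f ρ) (hμ : Integrable f μ) :
    ∫ x, f x ∂(mixture ρ μ t) = (1 - t) * ∫ x, f x ∂ρ + t * ∫ x, f x ∂μ := by
  rw [mixture, integral_add_measure (hρ.smul_measure ENNReal.ofReal_ne_top)
    (hμ.smul_measure ENNReal.ofReal_ne_top), integral_smul_measure, integral_smul_measure,
    ENNReal.toReal_ofReal (by linarith [ht.2]), ENNReal.toReal_ofReal ht.1, smul_eq_mul,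
    smul_eq_mul]

theorem isProbabilityMeasure_mixture {ρ μ : Measure (Euc d)} [IsProbabilityMeasure ρ]
    [IsProbabilityMeasure μ] {t : ℝ} (ht : t ∈ Set.Icc (0 : ℝ) 1) :
    IsProbabilityMeasure (mixture ρ μ t) := by
  constructor
  simp only [mixture, Measure.coe_add, Measure.coe_smul, Pi.add_apply, Pi.smul_apply,
    measure_univ, smul_eq_mul, mul_one]
  rw [← ENNReal.ofReal_add (by linarith [ht.2]) ht.1]
  simp

theorem ae_mixture {ρ μ : Measure (Euc d)} {t : ℝ} {p : Euc d → Prop} (hρ : ∀ᵐ x ∂ρ, p x)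
    (hμ : ∀ᵐ x ∂μ, p x) : ∀ᵐ x ∂(mixture ρ μ t), p x := by
  rw [mixture, ae_add_measure_iff]
  exact ⟨Measure.ae_smul_measure hρ _, Measure.ae_smul_measure hμ _⟩

theorem regKL_eq {ρ : Measure (Euc d)} (hρ : ∀ᵐ x ∂ρ, x ∈ C) :
    regKL C U ε ρ = ∫ x, (U x + Real.log (gaussConv ε ρ x)) ∂ρ := by
  rw [regKL, Measure.restrict_eq_self_of_ae_mem hρ]

/-- The logarithmic term along a mixture, integrated against a third measure. -/
theorem abs_integral_log_gaussConv_mixture_sub_le (hε : 0 < ε) {ρ μ η : Measure (Euc d)}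
    [IsProbabilityMeasure ρ] [IsProbabilityMeasure μ] [IsProbabilityMeasure η]
    (hρ : ∀ᵐ x ∂ρ, ‖x‖ ≤ R) (hμ : ∀ᵐ x ∂μ, ‖x‖ ≤ R) (hη : ∀ᵐ x ∂η, ‖x‖ ≤ R) {t : ℝ}
    (ht : t ∈ Set.Icc (0 : ℝ) 1) :
    |∫ x, Real.log (gaussConv ε (mixture ρ μ t) x) ∂η - ∫ x, Real.log (gaussConv ε ρ x) ∂η
      - t * ∫ x, (gaussConv ε ρ x)⁻¹ * (gaussConv ε μ x - gaussConv ε ρ x) ∂η|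
      ≤ t ^ 2 / Real.exp (-(2 * R ^ 2 / ε)) ^ 2 := by
  have := isProbabilityMeasure_mixture (ρ := ρ) (μ := μ) ht
  have i1 := integrable_log_gaussConv hε (ae_mixture (t := t) hρ hμ) hη
  have i2 := integrable_log_gaussConv hε hρ hη
  have ha := continuous_gaussConv hε ρ
  have hb := continuous_gaussConv hε μ
  have hdiff : ∀ x, |gaussConv ε μ x - gaussConv ε ρ x| ≤ 1 := fun x => by
    rw [abs_le]
    constructor <;> linarith [gaussConv_nonneg (ε := ε) ρ x, gaussConv_le_one hε ρ x,
      gaussConv_nonneg (ε := ε) μ x, gaussConv_le_one hε μ x]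
  have i3 : Integrable
      (fun x => t * ((gaussConv ε ρ x)⁻¹ * (gaussConv ε μ x - gaussConv ε ρ x))) η := by
    refine Integrable.const_mul (Integrable.of_bound (((measurable_inv_gaussConv hε ρ).mul
      (hb.measurable.sub ha.measurable)).aestronglyMeasurable)
      ((Real.exp (-(2 * R ^ 2 / ε)))⁻¹ * 1) (hη.mono fun x hx => ?_)) t
    rw [Pi.mul_apply, norm_mul, Real.norm_eq_abs, Real.norm_eq_abs]
    have := inv_gaussConv_le hε hρ hx
    gcongr
    exact hdiff x
  rw [← integral_const_mul, ← integral_sub i1 i2, ← integral_sub (i1.sub' i2) i3]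
  have := norm_integral_le_of_norm_le_const (μ := η)
    (C := t ^ 2 / Real.exp (-(2 * R ^ 2 / ε)) ^ 2)
    (f := fun x => Real.log (gaussConv ε (mixture ρ μ t) x) - Real.log (gaussConv ε ρ x)
      - t * ((gaussConv ε ρ x)⁻¹ * (gaussConv ε μ x - gaussConv ε ρ x))) ?_
  · simpa using this
  · filter_upwards [hη] with x hx
    have e : gaussConv ε (mixture ρ μ t) x - gaussConv ε ρ x
        = t * (gaussConv ε μ x - gaussConv ε ρ x) := by
      have : gaussConv ε (mixture ρ μ t) x
          = (1 - t) * gaussConv ε ρ x + t * gaussConv ε μ x :=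
        integral_mixture ht (integrable_gaussKernel_sub hε ρ x) (integrable_gaussKernel_sub hε μ x)
      rw [this]; ring
    have h := Real.abs_log_sub_log_sub_le (Real.exp_pos _) (gaussConv_ge hε hρ hx)
      (gaussConv_ge hε (ae_mixture (t := t) hρ hμ) hx)
    rw [e, mul_left_comm] at h
    refine h.trans ?_
    rw [mul_pow]
    have : (gaussConv ε μ x - gaussConv ε ρ x) ^ 2 ≤ 1 := by
      rw [sq_le_one_iff_abs_le_one]; exact hdiff x
    gcongr
    nlinarith [sq_nonneg t]

/-- Along the mixture, the integrand changes at rate `(φ_ε * (μ - ρ)) / (φ_ε * ρ)`, up to `t² / m²`.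
Its integral against `ρ` is the potential term; its integral against `μ` enters only at order `t²`.
-/
theorem isFirstVariation_klVariation (hU : HasLipschitzGradientOn C U C₁)
    (hC₁ : 0 ≤ C₁) (hC : Convex ℝ C) (hCm : MeasurableSet C) (hR : C ⊆ Metric.closedBall 0 R)
    (hε : 0 < ε) {ρ : Measure (Euc d)} (hρ : ρ ∈ P2 C) :
    IsFirstVariation C (regKL C U ε) ρ (klVariation U ε ρ) := by
  obtain ⟨hρp, hρC, -⟩ := hρ
  have hρR := ae_norm_le_of_mem_P2 hR hρC
  refine ⟨integrable_klVariation hU hC₁ hC hCm hR hε hρC hρC, ?_⟩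
  rintro μ ⟨hμp, hμC, -⟩
  have hμR := ae_norm_le_of_mem_P2 hR hμC
  refine ⟨integrable_klVariation hU hC₁ hC hCm hR hε hρC hμC, ?_⟩
  set J : Measure (Euc d) → ℝ := fun η =>
    ∫ x, (gaussConv ε ρ x)⁻¹ * (gaussConv ε μ x - gaussConv ε ρ x) ∂η with hJ
  set m := Real.exp (-(2 * R ^ 2 / ε))
  have hm : 0 < m := Real.exp_pos _
  have iU : ∀ {η : Measure (Euc d)} [IsProbabilityMeasure η], (∀ᵐ x ∂η, x ∈ C) →
      Integrable U η := fun h => hU.integrable hC₁ hC hCm hR h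
  have hkl : ∀ t ∈ Set.Icc (0 : ℝ) 1, regKL C U ε (mixture ρ μ t)
      = (1 - t) * (∫ x, U x ∂ρ + ∫ x, Real.log (gaussConv ε (mixture ρ μ t) x) ∂ρ)
        + t * (∫ x, U x ∂μ + ∫ x, Real.log (gaussConv ε (mixture ρ μ t) x) ∂μ) := by
    intro t ht
    have := isProbabilityMeasure_mixture (ρ := ρ) (μ := μ) ht
    have hl : ∀ {η : Measure (Euc d)} [IsProbabilityMeasure η], (∀ᵐ x ∂η, ‖x‖ ≤ R) →
        Integrable (fun x => Real.log (gaussConv ε (mixture ρ μ t) x)) η := fun h =>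
      integrable_log_gaussConv hε (ae_mixture (t := t) hρR hμR) h
    rw [regKL_eq (ae_mixture hρC hμC), integral_mixture ht ((iU hρC).fun_add (hl hρR))
      ((iU hμC).fun_add (hl hμR)), integral_add (iU hρC) (hl hρR), integral_add (iU hμC) (hl hμR)]
  have hmix0 : mixture ρ μ 0 = ρ := by simp [mixture]
  have h0 : regKL C U ε (mixture ρ μ 0)
      = ∫ x, U x ∂ρ + ∫ x, Real.log (gaussConv ε ρ x) ∂ρ := by
    rw [hkl 0 (by simp), hmix0]; ring
  have hpot : ∫ x, gaussPot ε ρ x ∂μ - ∫ x, gaussPot ε ρ x ∂ρ = J ρ := by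
    rw [← integral_gaussConv_div hε hρR, ← integral_gaussConv_div hε hρR, ← integral_sub]
    · simp only [hJ, mul_sub]
    all_goals
      refine Integrable.of_bound (((measurable_inv_gaussConv hε ρ).mul
        (continuous_gaussConv hε _).measurable).aestronglyMeasurable)
        (m⁻¹ * 1) (hρR.mono fun x hx => ?_)
      rw [norm_mul, Real.norm_eq_abs, Real.norm_of_nonneg (gaussConv_nonneg _ x)]
      gcongr
      · exact gaussConv_nonneg _ x
      · exact inv_gaussConv_le hε hρR hx
      · exact gaussConv_le_one hε _ x
  have hV : ∀ {η : Measure (Euc d)} [IsProbabilityMeasure η], (∀ᵐ x ∂η, x ∈ C) →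
      ∫ x, klVariation U ε ρ x ∂η
        = ∫ x, U x ∂η + (∫ x, Real.log (gaussConv ε ρ x) ∂η + ∫ x, gaussPot ε ρ x ∂η) := by
    intro η _ hη
    have hl := integrable_log_gaussConv hε hρR (ae_norm_le_of_mem_P2 hR hη)
    have hp : Integrable (gaussPot ε ρ) η := integrable_gaussPot hε hρR
    rw [← integral_add hl hp, ← integral_add (iU hη) (hl.fun_add hp)]
    rfl
  rw [hasDerivWithinAt_iff_hasFDerivWithinAt]
  refine HasFDerivWithinAt.of_sq_bound (|J μ - J ρ| + 1 / m ^ 2) fun t ht => ?_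
  have r1 := abs_integral_log_gaussConv_mixture_sub_le hε hρR hμR hρR ht
  have r2 := abs_integral_log_gaussConv_mixture_sub_le hε hρR hμR hμR ht
  change |_ - _ - t * J ρ| ≤ _ at r1
  change |_ - _ - t * J μ| ≤ _ at r2
  set e1 := ∫ x, Real.log (gaussConv ε (mixture ρ μ t) x) ∂ρ
    - ∫ x, Real.log (gaussConv ε ρ x) ∂ρ - t * J ρ with he1
  set e2 := ∫ x, Real.log (gaussConv ε (mixture ρ μ t) x) ∂μ
    - ∫ x, Real.log (gaussConv ε ρ x) ∂μ - t * J μ with he2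
  -- The logarithms contribute `(1 - t) t J ρ + t² J μ`, against the linear term `t J ρ`; the
  -- difference is `t² (J μ - J ρ)`.
  have key : regKL C U ε (mixture ρ μ t) - regKL C U ε (mixture ρ μ 0)
      - t * (∫ x, klVariation U ε ρ x ∂μ - ∫ x, klVariation U ε ρ x ∂ρ)
      = t ^ 2 * (J μ - J ρ) + ((1 - t) * e1 + t * e2) := by
    rw [hkl t ht, h0, hV hρC, hV hμC]
    linear_combination -t * hpot - (1 - t) * he1 - t * he2
  have hb : |(1 - t) * e1 + t * e2| ≤ t ^ 2 / m ^ 2 := by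
    have h1 : |(1 - t) * e1| ≤ (1 - t) * (t ^ 2 / m ^ 2) := by
      rw [abs_mul, abs_of_nonneg (by linarith [ht.2])]
      exact mul_le_mul_of_nonneg_left r1 (by linarith [ht.2])
    have h2 : |t * e2| ≤ t * (t ^ 2 / m ^ 2) := by
      rw [abs_mul, abs_of_nonneg ht.1]
      exact mul_le_mul_of_nonneg_left r2 ht.1
    exact (abs_add_le _ _).trans (by linarith)
  simp only [sub_zero, ContinuousLinearMap.toSpanSingleton_apply, smul_eq_mul, Real.norm_eq_abs,
    sq_abs]
  rw [key]
  refine (abs_add_le _ _).trans ?_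
  rw [abs_mul, abs_of_nonneg (sq_nonneg t)]
  calc _ ≤ t ^ 2 * |J μ - J ρ| + t ^ 2 / m ^ 2 := by gcongr
    _ = _ := by ring

theorem hasGradientWithinAt_klVariation (hU : HasLipschitzGradientOn C U C₁)
    (hε : 0 < ε) {ρ : Measure (Euc d)} [IsProbabilityMeasure ρ] (hρ : ∀ᵐ x ∂ρ, ‖x‖ ≤ R)
    {x : Euc d} (hx : x ∈ C) :
    HasGradientWithinAt (klVariation U ε ρ) (gradientWithin U C x + entropyGrad ε ρ x) C x :=
  (hU.hasGradientWithinAt hx).add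
    ((hasGradientAt_log_gaussConv_add_gaussPot hε hρ x).hasFDerivAt.hasFDerivWithinAt)

/-- A functional on `𝒫₂(C)` determines its first variation on `C` up to a constant. -/
theorem IsFirstVariation.eqOn_add_const {F : Measure (Euc d) → ℝ} {ρ : Measure (Euc d)}
    {V W : Euc d → ℝ} (hV : IsFirstVariation C F ρ V) (hW : IsFirstVariation C F ρ W) :
    ∀ x ∈ C, V x = W x + (∫ y, V y ∂ρ - ∫ y, W y ∂ρ) := by
  intro x hx
  -- Testing against the Dirac mass at `x` recovers the value at `x`, and one-sided derivatives at
  -- `0` on `[0, 1]` are unique.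
  have hd : Measure.dirac x ∈ P2 C := by
    refine ⟨inferInstance, ?_, ?_⟩
    · rw [ae_dirac_eq]; exact hx
    · exact integrable_dirac (by simp)
  have h := (uniqueDiffOn_Icc (zero_lt_one' ℝ) 0 (by simp)).eq_deriv _ (hV.2 _ hd).2
    (hW.2 _ hd).2
  rw [integral_dirac, integral_dirac] at h
  linarith

theorem IsFirstVariation.hasGradientWithinAt_of_eq {F : Measure (Euc d) → ℝ}
    {ρ : Measure (Euc d)} {V W : Euc d → ℝ} (hV : IsFirstVariation C F ρ V)
    (hW : IsFirstVariation C F ρ W) {g x : Euc d} (hx : x ∈ C)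
    (h : HasGradientWithinAt W g C x) : HasGradientWithinAt V g C x := by
  have h1 : HasGradientWithinAt (fun x => W x + (∫ y, V y ∂ρ - ∫ y, W y ∂ρ)) g C x := by
    simpa using h.add (hasGradientWithinAt_const x _ _)
  exact h1.congr_of_mem (hV.eqOn_add_const hW) hx

theorem IsFirstVariation.hasGradientWithinAt (hU : HasLipschitzGradientOn C U C₁)
    (hC₁ : 0 ≤ C₁) (hC : Convex ℝ C) (hCm : MeasurableSet C) (hR : C ⊆ Metric.closedBall 0 R)
    (hε : 0 < ε) {ρ : Measure (Euc d)} (hρ : ρ ∈ P2 C) {V : Euc d → ℝ}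
    (hV : IsFirstVariation C (regKL C U ε) ρ V) {x : Euc d} (hx : x ∈ C) :
    HasGradientWithinAt V (gradientWithin U C x + entropyGrad ε ρ x) C x :=
  have := hρ.1
  hV.hasGradientWithinAt_of_eq (isFirstVariation_klVariation hU hC₁ hC hCm hR hε hρ) hx
    (hasGradientWithinAt_klVariation hU hε (ae_norm_le_of_mem_P2 hR hρ.2.1) hx)

end FirstVariation

/-! ### Measurability of the kernel and its gradient -/

section Measurability

variable {d : ℕ} {ε : ℝ}

@[fun_prop]
theorem measurable_gaussKernel : Measurable (gaussKernel ε : Euc d → ℝ) :=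
  continuous_gaussKernel.measurable

@[fun_prop]
theorem measurable_gaussGrad : Measurable (gaussGrad ε : Euc d → Euc d) :=
  continuous_gaussGrad.measurable

end Measurability

/-! ### Pointwise estimates along two maps -/

section Deviation

variable {d : ℕ} {Z : Type*} {ε R : ℝ} {X Y : Z → Euc d}

theorem norm_sub_sub_comm (w z : Z) :
    ‖(Y z - Y w) - (X z - X w)‖ = ‖(Y z - X z) - (Y w - X w)‖ := by
  congr 1; abel

theorem norm_sub_le_two_mul (hX : ∀ z, ‖X z‖ ≤ R) (z w : Z) : ‖X z - X w‖ ≤ 2 * R :=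
  (norm_sub_le _ _).trans (by linarith [hX z, hX w])

theorem norm_sub_le_two_mul' (hX : ∀ z, ‖X z‖ ≤ R) (hY : ∀ z, ‖Y z‖ ≤ R) (z : Z) :
    ‖Y z - X z‖ ≤ 2 * R :=
  (norm_sub_le _ _).trans (by linarith [hX z, hY z])

theorem norm_gaussGrad_sub_le_two_mul (hε : 0 < ε) (hX : ∀ z, ‖X z‖ ≤ R) (z w : Z) :
    ‖gaussGrad ε (X z - X w)‖ ≤ 2 * R / ε :=
  (norm_gaussGrad_le hε _).trans (by gcongr; exact norm_sub_le_two_mul hX z w)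

/-- A weighted kernel-gradient integral depends on the weight and the map in a Lipschitz way. -/
theorem norm_smul_gaussGrad_sub_le (hε : 0 < ε) (hX : ∀ z, ‖X z‖ ≤ R)
    {a b B : ℝ} (hb : |b| ≤ B) (z w : Z) :
    ‖b • gaussGrad ε (Y z - Y w) - a • gaussGrad ε (X z - X w)‖
      ≤ B / ε * ‖(Y z - X z) - (Y w - X w)‖ + 2 * R / ε * |b - a| := by
  have e : b • gaussGrad ε (Y z - Y w) - a • gaussGrad ε (X z - X w)
      = b • (gaussGrad ε (Y z - Y w) - gaussGrad ε (X z - X w))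
        + (b - a) • gaussGrad ε (X z - X w) := by
    rw [smul_sub, sub_smul]; abel
  rw [e]
  refine (norm_add_le _ _).trans (add_le_add ?_ ?_)
  · rw [norm_smul, Real.norm_eq_abs, ← norm_sub_sub_comm]
    calc _ ≤ B * (1 / ε * ‖(Y z - Y w) - (X z - X w)‖) := by
          have := (abs_nonneg _).trans hb
          gcongr
          exact norm_gaussGrad_sub_le hε _ _
      _ = _ := by ring
  · rw [norm_smul, Real.norm_eq_abs, mul_comm]
    gcongr
    exact norm_gaussGrad_sub_le_two_mul hε hX z w

end Deviation

/-! ### Convolutions with the law of a map -/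

section LawMap

variable {d : ℕ} {Z : Type*} [MeasurableSpace Z] {ν : Measure Z} {ε R : ℝ} {X : Z → Euc d}

theorem ae_map_norm_le (hXm : Measurable X) (hX : ∀ z, ‖X z‖ ≤ R) :
    ∀ᵐ x ∂(ν.map X), ‖x‖ ≤ R := by
  rw [ae_map_iff hXm.aemeasurable (measurableSet_le (by fun_prop) (by fun_prop))]
  exact .of_forall hX

theorem gaussConv_map (hXm : Measurable X) (x : Euc d) :
    gaussConv ε (ν.map X) x = ∫ w, gaussKernel ε (x - X w) ∂ν := by
  rw [gaussConv, integral_map hXm.aemeasurable (by fun_prop)]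

end LawMap

/-! ### Mean deviations and the Lipschitz constant -/

section LawEstimates

variable {d : ℕ} {Z : Type*} [MeasurableSpace Z] {ν : Measure Z} [IsProbabilityMeasure ν]
  {ε R : ℝ} {X Y H : Z → Euc d}

theorem sq_integral_le_integral_sq {f : Z → ℝ} (hf : Integrable f ν)
    (hf2 : Integrable (fun z => f z ^ 2) ν) : (∫ z, f z ∂ν) ^ 2 ≤ ∫ z, f z ^ 2 ∂ν := by
  set c := ∫ z, f z ∂ν with hc
  have h : 0 ≤ ∫ z, (f z - c) ^ 2 ∂ν := integral_nonneg fun _ => sq_nonneg _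
  have e : ∀ z, (f z - c) ^ 2 = f z ^ 2 - (2 * c * f z - c ^ 2) := fun z => by ring
  simp only [e] at h
  have i1 : Integrable (fun z => 2 * c * f z) ν := hf.const_mul _
  rw [integral_sub hf2 (i1.sub' (integrable_const _)), integral_sub i1 (integrable_const _),
    integral_const_mul, ← hc] at h
  simp only [integral_const, probReal_univ, one_smul] at h
  nlinarith

theorem integrable_norm_sub (hH : Measurable H) {B : ℝ} (hB : ∀ z, ‖H z‖ ≤ B) (n : ℕ) (z : Z) :
    Integrable (fun w => ‖H z - H w‖ ^ n) ν := by
  refine Integrable.of_bound (by fun_prop) ((B + B) ^ n) (.of_forall fun w => ?_)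
  rw [norm_pow, norm_norm]
  gcongr
  exact (norm_sub_le _ _).trans (add_le_add (hB z) (hB w))

theorem integrable_integral_norm_sub (hH : Measurable H) {B : ℝ} (hB : ∀ z, ‖H z‖ ≤ B) (n : ℕ) :
    Integrable (fun z => ∫ w, ‖H z - H w‖ ^ n ∂ν) ν := by
  have : Integrable (fun p : Z × Z => ‖H p.1 - H p.2‖ ^ n) (ν.prod ν) := by
    refine Integrable.of_bound (by fun_prop) ((B + B) ^ n) (.of_forall fun w => ?_)
    rw [norm_pow, norm_norm]
    gcongr
    exact (norm_sub_le _ _).trans (add_le_add (hB _) (hB _))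
  exact this.integral_prod_left

/-- The double integral equals `2 (∫ ‖H‖² - ‖∫ H‖²)`. The triangle inequality alone would give the
factor `4`. -/
theorem integral_integral_norm_sub_sq_le (hH : Measurable H) {B : ℝ} (hB : ∀ z, ‖H z‖ ≤ B) :
    ∫ z, ∫ w, ‖H z - H w‖ ^ 2 ∂ν ∂ν ≤ 2 * ∫ z, ‖H z‖ ^ 2 ∂ν := by
  have iH : Integrable H ν := Integrable.of_bound (by fun_prop) B (.of_forall hB)
  have iH2 : Integrable (fun z => ‖H z‖ ^ 2) ν := by
    refine Integrable.of_bound (by fun_prop) (B ^ 2) (.of_forall fun w => ?_)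
    rw [norm_pow, norm_norm]
    have := hB w
    gcongr
  set c := ∫ z, H z ∂ν with hc
  have h1 : ∀ z, ∫ w, ‖H z - H w‖ ^ 2 ∂ν
      = ‖H z‖ ^ 2 - 2 * inner ℝ c (H z) + ∫ w, ‖H w‖ ^ 2 ∂ν := by
    intro z
    simp only [norm_sub_sq_real]
    have i1 : Integrable (fun w => 2 * inner ℝ (H z) (H w)) ν :=
      (iH.const_inner (H z)).const_mul 2
    rw [integral_add ((integrable_const _).sub' i1) iH2, integral_sub (integrable_const _) i1,
      integral_const_mul, integral_inner iH, ← hc, real_inner_comm]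
    simp
  simp only [h1]
  have i1 : Integrable (fun w => 2 * inner ℝ c (H w)) ν := (iH.const_inner c).const_mul 2
  rw [integral_add (iH2.sub' i1) (integrable_const _), integral_sub iH2 i1,
      integral_const_mul, integral_inner iH, ← hc, real_inner_self_eq_norm_sq]
  simp only [integral_const, probReal_univ, one_smul]
  nlinarith [sq_nonneg ‖c‖]

theorem sq_integral_norm_sub_le (hH : Measurable H) {B : ℝ} (hB : ∀ z, ‖H z‖ ≤ B) (z : Z) :
    (∫ w, ‖H z - H w‖ ∂ν) ^ 2 ≤ ∫ w, ‖H z - H w‖ ^ 2 ∂ν := by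
  refine sq_integral_le_integral_sq ?_ (integrable_norm_sub hH hB 2 z)
  simpa using integrable_norm_sub (ν := ν) hH hB 1 z

theorem entropyGrad_map (hε : 0 < ε) (hXm : Measurable X) (x : Euc d) :
    entropyGrad ε (ν.map X) x
      = (gaussConv ε (ν.map X) x)⁻¹ • ∫ w, gaussGrad ε (x - X w) ∂ν +
        ∫ w, (gaussConv ε (ν.map X) (X w))⁻¹ • gaussGrad ε (x - X w) ∂ν := by
  have := Measure.isProbabilityMeasure_map (μ := ν) hXm.aemeasurable
  have := measurable_inv_gaussConv hε (ν.map X)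
  rw [entropyGrad, integral_map hXm.aemeasurable (by fun_prop),
    integral_map hXm.aemeasurable (by fun_prop)]

theorem measurable_inv_gaussConv_map (hε : 0 < ε) (hXm : Measurable X) :
    Measurable fun z => (gaussConv ε (ν.map X) (X z))⁻¹ :=
  have := Measure.isProbabilityMeasure_map (μ := ν) hXm.aemeasurable
  (measurable_inv_gaussConv hε _).comp hXm

theorem inv_gaussConv_map_le (hε : 0 < ε) (hXm : Measurable X) (hX : ∀ z, ‖X z‖ ≤ R) (z : Z) :
    |(gaussConv ε (ν.map X) (X z))⁻¹| ≤ (Real.exp (-(2 * R ^ 2 / ε)))⁻¹ :=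
  have := Measure.isProbabilityMeasure_map (μ := ν) hXm.aemeasurable
  inv_gaussConv_le hε (ae_map_norm_le hXm hX) (hX z)

theorem gaussConv_map_ge (hε : 0 < ε) (hXm : Measurable X) (hX : ∀ z, ‖X z‖ ≤ R) (z : Z) :
    Real.exp (-(2 * R ^ 2 / ε)) ≤ gaussConv ε (ν.map X) (X z) :=
  have := Measure.isProbabilityMeasure_map (μ := ν) hXm.aemeasurable
  gaussConv_ge hε (ae_map_norm_le hXm hX) (hX z)

theorem integrable_gaussKernel_comp (hε : 0 < ε) (hXm : Measurable X) (x : Euc d) :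
    Integrable (fun w => gaussKernel ε (x - X w)) ν := by
  refine Integrable.of_bound (by fun_prop) 1 (.of_forall fun z => ?_)
  rw [Real.norm_of_nonneg (gaussKernel_pos _).le]
  exact gaussKernel_le_one hε _

theorem integrable_smul_gaussGrad_comp (hε : 0 < ε) (hXm : Measurable X) (hX : ∀ z, ‖X z‖ ≤ R)
    {c : Z → ℝ} {B : ℝ} (hc : Measurable c) (hcB : ∀ z, |c z| ≤ B) (z : Z) :
    Integrable (fun w => c w • gaussGrad ε (X z - X w)) ν := by
  refine Integrable.of_bound (by fun_prop) (B * (2 * R / ε)) (.of_forall fun w => ?_)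
  rw [norm_smul, Real.norm_eq_abs]
  have := (abs_nonneg _).trans (hcB w)
  gcongr
  exacts [hcB w, norm_gaussGrad_sub_le_two_mul hε hX z w]

theorem integrable_gaussGrad_comp (hε : 0 < ε) (hXm : Measurable X) (hX : ∀ z, ‖X z‖ ≤ R)
    (z : Z) : Integrable (fun w => gaussGrad ε (X z - X w)) ν := by
  simpa using integrable_smul_gaussGrad_comp hε hXm hX (ν := ν) (c := fun _ => 1)
    measurable_const (B := 1) (by simp) z

theorem abs_gaussConv_map_sub_le (hε : 0 < ε) (hXm : Measurable X) (hX : ∀ z, ‖X z‖ ≤ R)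
    (hYm : Measurable Y) (hY : ∀ z, ‖Y z‖ ≤ R) (z : Z) :
    |gaussConv ε (ν.map Y) (Y z) - gaussConv ε (ν.map X) (X z)|
      ≤ 2 * R / ε * ∫ w, ‖(Y z - X z) - (Y w - X w)‖ ∂ν := by
  rw [gaussConv_map hXm, gaussConv_map hYm,
    ← integral_sub (integrable_gaussKernel_comp hε hYm _) (integrable_gaussKernel_comp hε hXm _),
    ← integral_const_mul]
  have hi := integrable_norm_sub (ν := ν) (hYm.sub hXm) (norm_sub_le_two_mul' hX hY) 1 z
  simp only [Pi.sub_apply, pow_one] at hi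
  rw [← Real.norm_eq_abs]
  refine norm_integral_le_of_norm_le (hi.const_mul (2 * R / ε)) (.of_forall fun w => ?_)
  rw [← norm_sub_sub_comm]
  exact abs_gaussKernel_sub_le hε (norm_sub_le_two_mul hY z w) (norm_sub_le_two_mul hX z w)

theorem abs_inv_gaussConv_map_sub_le (hε : 0 < ε) (hXm : Measurable X) (hX : ∀ z, ‖X z‖ ≤ R)
    (hYm : Measurable Y) (hY : ∀ z, ‖Y z‖ ≤ R) (z : Z) :
    |(gaussConv ε (ν.map Y) (Y z))⁻¹ - (gaussConv ε (ν.map X) (X z))⁻¹|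
      ≤ 2 * R / ε / Real.exp (-(2 * R ^ 2 / ε)) ^ 2 *
        ∫ w, ‖(Y z - X z) - (Y w - X w)‖ ∂ν := by
  have h := abs_gaussConv_map_sub_le hε hXm hX hYm hY z (ν := ν)
  have ha := gaussConv_map_ge hε hXm hX z (ν := ν)
  have hb := gaussConv_map_ge hε hYm hY z (ν := ν)
  set a := gaussConv ε (ν.map X) (X z)
  set b := gaussConv ε (ν.map Y) (Y z)
  set m := Real.exp (-(2 * R ^ 2 / ε))
  have hm : 0 < m := Real.exp_pos _
  have ha' := hm.trans_le ha
  have hb' := hm.trans_le hb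
  have e : b⁻¹ - a⁻¹ = (a - b) / (b * a) := by field_simp
  rw [e, abs_div, abs_of_pos (mul_pos hb' ha'), abs_sub_comm]
  calc _ ≤ |b - a| / (m * m) := by gcongr
    _ ≤ (2 * R / ε * ∫ w, ‖(Y z - X z) - (Y w - X w)‖ ∂ν) / (m * m) := by gcongr
    _ = _ := by ring

/-- Each of the two integrals in `entropyGrad` varies through the kernel gradient, which costs `p D
z`, and through its weight. The weight sits at `z` in the first, costing `q D z`, and at the
integration variable in the second, costing `q ∫ D`. -/
theorem norm_entropyGrad_map_sub_le (hε : 0 < ε) (hXm : Measurable X) (hX : ∀ z, ‖X z‖ ≤ R)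
    (hYm : Measurable Y) (hY : ∀ z, ‖Y z‖ ≤ R) (z : Z) {p q : ℝ}
    (hp : p = (Real.exp (-(2 * R ^ 2 / ε)))⁻¹ / ε)
    (hq : q = 2 * R / ε * (2 * R / ε / Real.exp (-(2 * R ^ 2 / ε)) ^ 2)) :
    ‖entropyGrad ε (ν.map Y) (Y z) - entropyGrad ε (ν.map X) (X z)‖
      ≤ (2 * p + q) * (∫ w, ‖(Y z - X z) - (Y w - X w)‖ ∂ν)
        + q * ∫ v, ∫ w, ‖(Y v - X v) - (Y w - X w)‖ ∂ν ∂ν := by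
  have hR : 0 ≤ R := (norm_nonneg _).trans (hX z)
  have hcX := measurable_inv_gaussConv_map (ν := ν) hε hXm
  have hcY := measurable_inv_gaussConv_map (ν := ν) hε hYm
  have hbX := inv_gaussConv_map_le (ν := ν) hε hXm hX
  have hbY := inv_gaussConv_map_le (ν := ν) hε hYm hY
  have hinv := abs_inv_gaussConv_map_sub_le (ν := ν) hε hXm hX hYm hY
  have iX := integrable_gaussGrad_comp (ν := ν) hε hXm hX z
  have iY := integrable_gaussGrad_comp (ν := ν) hε hYm hY z
  have iX' := integrable_smul_gaussGrad_comp (ν := ν) hε hXm hX hcX hbX z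
  have iY' := integrable_smul_gaussGrad_comp (ν := ν) hε hYm hY hcY hbY z
  have hm := hYm.sub hXm
  have hHB := norm_sub_le_two_mul' hX hY
  have hi := integrable_norm_sub (ν := ν) hm hHB 1 z
  have hi2 := integrable_integral_norm_sub (ν := ν) hm hHB 1
  simp only [Pi.sub_apply, pow_one] at hi hi2
  set D : Z → ℝ := fun z => ∫ w, ‖(Y z - X z) - (Y w - X w)‖ ∂ν with hD
  rw [entropyGrad_map hε hXm, entropyGrad_map hε hYm, add_sub_add_comm, ← integral_smul,
    ← integral_smul, ← integral_sub (iY.fun_smul _) (iX.fun_smul _), ← integral_sub iY' iX']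
  have h1 : ‖∫ w, ((gaussConv ε (ν.map Y) (Y z))⁻¹ • gaussGrad ε (Y z - Y w) -
      (gaussConv ε (ν.map X) (X z))⁻¹ • gaussGrad ε (X z - X w)) ∂ν‖ ≤ p * D z + q * D z := by
    have hle := norm_integral_le_of_norm_le (μ := ν)
      (f := fun w => (gaussConv ε (ν.map Y) (Y z))⁻¹ • gaussGrad ε (Y z - Y w) -
        (gaussConv ε (ν.map X) (X z))⁻¹ • gaussGrad ε (X z - X w))
      (g := fun w => p * ‖(Y z - X z) - (Y w - X w)‖ + q * D z)
      ((hi.const_mul p).add (integrable_const _)) (.of_forall fun w => ?_)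
    · rw [integral_add (hi.const_mul p) (integrable_const _), integral_const_mul] at hle
      simpa using hle
    · refine (norm_smul_gaussGrad_sub_le hε hX (hbY z) z w).trans ?_
      rw [← hp, hq, mul_assoc (2 * R / ε)]
      gcongr
      exact hinv z
  have h2 : ‖∫ w, ((gaussConv ε (ν.map Y) (Y w))⁻¹ • gaussGrad ε (Y z - Y w) -
      (gaussConv ε (ν.map X) (X w))⁻¹ • gaussGrad ε (X z - X w)) ∂ν‖
      ≤ p * D z + q * ∫ v, D v ∂ν := by
    have hle := norm_integral_le_of_norm_le (μ := ν)
      (f := fun w => (gaussConv ε (ν.map Y) (Y w))⁻¹ • gaussGrad ε (Y z - Y w) -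
        (gaussConv ε (ν.map X) (X w))⁻¹ • gaussGrad ε (X z - X w))
      (g := fun w => p * ‖(Y z - X z) - (Y w - X w)‖ + q * D w)
      ((hi.const_mul p).add (hi2.const_mul q)) (.of_forall fun w => ?_)
    · rwa [integral_add (hi.const_mul p) (hi2.const_mul q), integral_const_mul,
        integral_const_mul] at hle
    · refine (norm_smul_gaussGrad_sub_le hε hX (hbY w) z w).trans ?_
      rw [← hp, hq, mul_assoc (2 * R / ε)]
      gcongr
      exact hinv w
  refine (norm_add_le _ _).trans ((add_le_add h1 h2).trans_eq ?_)
  ring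

/-- With `r = R² / ε` the left side is `(3/ε)(exp(2r) + 4r exp(4r))`. Then `exp(2r) ≤ exp(4r)` and
`1 + 4r ≤ exp(4r)` give `exp(8r)`. -/
theorem three_halves_mul_le_exp {p q : ℝ} (hε : 0 < ε)
    (hp : p = (Real.exp (-(2 * R ^ 2 / ε)))⁻¹ / ε)
    (hq : q = 2 * R / ε * (2 * R / ε / Real.exp (-(2 * R ^ 2 / ε)) ^ 2)) :
    3 / 2 * (2 * p + 2 * q) ≤ 3 / ε * Real.exp (8 * R ^ 2 / ε) := by
  set r := R ^ 2 / ε with hr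
  have hr0 : 0 ≤ r := by positivity
  have e1 : (Real.exp (-(2 * R ^ 2 / ε)))⁻¹ = Real.exp (2 * r) := by
    rw [← Real.exp_neg]; congr 1; rw [hr]; ring
  have e2 : Real.exp (8 * R ^ 2 / ε) = Real.exp (4 * r) * Real.exp (4 * r) := by
    rw [← Real.exp_add]; congr 1; rw [hr]; ring
  have e3 : q = 1 / ε * (4 * r * Real.exp (4 * r)) := by
    have : Real.exp (4 * r) = (Real.exp (-(2 * R ^ 2 / ε)))⁻¹ ^ 2 := by
      rw [e1, ← Real.exp_nat_mul]; congr 1; push_cast; ring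
    rw [this, hq, hr]
    field_simp
    ring
  rw [hp, e3, e1, e2]
  have h1 : Real.exp (2 * r) ≤ Real.exp (4 * r) := by gcongr; linarith
  have h2 := Real.add_one_le_exp (4 * r)
  have h3 : Real.exp (2 * r) + 4 * r * Real.exp (4 * r) ≤ Real.exp (4 * r) * Real.exp (4 * r) := by
    nlinarith [Real.exp_pos (4 * r)]
  calc _ = 3 / ε * (Real.exp (2 * r) + 4 * r * Real.exp (4 * r)) := by ring
    _ ≤ _ := by gcongr

/-- A pointwise bound by `C₁ ‖H‖` and the mean deviations of `H` gives an `L²` bound. -/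
theorem integral_sq_le_of_le_mean_deviation (hH : Measurable H) {B : ℝ} (hB : ∀ z, ‖H z‖ ≤ B)
    {N : Z → ℝ} {C₁ s t K : ℝ} (hC₁ : 0 ≤ C₁) (hs : 0 ≤ s) (ht : 0 ≤ t) (hN0 : ∀ᵐ z ∂ν, 0 ≤ N z)
    (hN : ∀ᵐ z ∂ν, N z ≤ C₁ * ‖H z‖ + s * (∫ w, ‖H z - H w‖ ∂ν)
      + t * ∫ v, ∫ w, ‖H v - H w‖ ∂ν ∂ν) (hK : 3 / 2 * (s + t) ≤ K) :
    ∫ z, N z ^ 2 ∂ν ≤ (C₁ + K) ^ 2 * ∫ z, ‖H z‖ ^ 2 ∂ν := by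
  set D : Z → ℝ := fun z => ∫ w, ‖H z - H w‖ ∂ν with hD
  set S : Z → ℝ := fun z => ∫ w, ‖H z - H w‖ ^ 2 ∂ν with hS
  set E := ∫ v, D v ∂ν with hE
  set L := C₁ + 3 / 2 * (s + t) with hL
  have hDS : ∀ z, D z ^ 2 ≤ S z := sq_integral_norm_sub_le hH hB
  have iD : Integrable D ν := by simpa using integrable_integral_norm_sub (ν := ν) hH hB 1
  have iS : Integrable S ν := integrable_integral_norm_sub (ν := ν) hH hB 2
  have iD2 : Integrable (fun z => D z ^ 2) ν := by
    refine iS.mono' (iD.aestronglyMeasurable.pow 2) (.of_forall fun z => ?_)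
    rw [norm_pow, Real.norm_eq_abs, sq_abs]
    exact hDS z
  have iH2 : Integrable (fun z => ‖H z‖ ^ 2) ν := by
    refine Integrable.of_bound (by fun_prop) (B ^ 2) (.of_forall fun w => ?_)
    rw [norm_pow, norm_norm]
    have := hB w
    gcongr
  have hSint : ∫ z, S z ∂ν ≤ 2 * ∫ z, ‖H z‖ ^ 2 ∂ν := integral_integral_norm_sub_sq_le hH hB
  have hE2 : E ^ 2 ≤ ∫ z, S z ∂ν :=
    (sq_integral_le_integral_sq iD iD2).trans (integral_mono iD2 iS hDS)
  set I := ∫ z, ‖H z‖ ^ 2 ∂ν with hI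
  have hI0 : 0 ≤ I := integral_nonneg fun _ => sq_nonneg _
  have hD0 : ∀ z, 0 ≤ D z := fun z => integral_nonneg fun _ => norm_nonneg _
  have hE0 : 0 ≤ E := integral_nonneg hD0
  -- Cauchy–Schwarz with weights `C₁`, `3s/2`, `3t/2`. Since `D²` and `E²` cost a factor `2` in the
  -- mean, the ideal ratio would be `√2`; `3/2` works because `(2/3) · 2 = 4/3 ≤ 3/2`.
  have hpt : ∀ᵐ z ∂ν, N z ^ 2 ≤ L * (C₁ * ‖H z‖ ^ 2 + (2 / 3 * s) * S z + 2 / 3 * t * E ^ 2) := by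
    filter_upwards [hN0, hN] with z h0 h
    calc N z ^ 2 ≤ (C₁ * ‖H z‖ + s * D z + t * E) ^ 2 := by gcongr
      _ ≤ L * (C₁ * ‖H z‖ ^ 2 + (2 / 3 * s) * D z ^ 2 + 2 / 3 * t * E ^ 2) := by
        rw [hL]
        have h1 := mul_nonneg (mul_nonneg hC₁ hs) (sq_nonneg (‖H z‖ - 2 / 3 * D z))
        have h2 := mul_nonneg (mul_nonneg hC₁ ht) (sq_nonneg (‖H z‖ - 2 / 3 * E))
        have h3 := mul_nonneg (mul_nonneg hs ht) (sq_nonneg (D z - E))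
        linarith
      _ ≤ _ := by
        have := hDS z
        gcongr
  have i1 : Integrable (fun z => C₁ * ‖H z‖ ^ 2) ν := iH2.const_mul _
  have i2 : Integrable (fun z => (2 / 3 * s) * S z) ν := iS.const_mul _
  have hL0 : 0 ≤ L := by positivity
  calc ∫ z, N z ^ 2 ∂ν
      ≤ ∫ z, L * (C₁ * ‖H z‖ ^ 2 + (2 / 3 * s) * S z + 2 / 3 * t * E ^ 2) ∂ν := by
        refine integral_mono_of_nonneg (.of_forall fun _ => sq_nonneg _) ?_ hpt
        exact ((i1.add i2).add (integrable_const _)).const_mul L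
    _ = L * (C₁ * I + (2 / 3 * s) * (∫ z, S z ∂ν) + 2 / 3 * t * E ^ 2) := by
        rw [integral_const_mul, integral_add (i1.fun_add i2) (integrable_const _),
          integral_add i1 i2, integral_const_mul, integral_const_mul]
        simp [hI]
    _ ≤ L * (C₁ * I + (2 / 3 * s) * (2 * I) + 2 / 3 * t * (2 * I)) := by
        have := hE2.trans hSint
        gcongr
    _ ≤ L * (L * I) := by
        rw [hL]
        gcongr
        nlinarith [mul_nonneg hs hI0, mul_nonneg ht hI0]
    _ = L ^ 2 * I := by ring
    _ ≤ _ := by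
        gcongr
        linarith

end LawEstimates

/-! ### The linear term of the lifting -/

section LiftRemainder

variable {d : ℕ} {Z : Type*} [MeasurableSpace Z] {ν : Measure Z} [IsProbabilityMeasure ν]
  {ε R : ℝ} {X H : Z → Euc d}

theorem integrable_prod_mul_inner_gaussGrad (hε : 0 < ε) (hXm : Measurable X)
    (hX : ∀ z, ‖X z‖ ≤ R) (hHm : Measurable H) {B : ℝ} (hH : ∀ z, ‖H z‖ ≤ B)
    {c : Z → ℝ} {A : ℝ} (hc : Measurable c) (hcA : ∀ z, |c z| ≤ A)
    {f g : Z × Z → Z} (hf : Measurable f) (hg : Measurable g) :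
    Integrable (fun p : Z × Z => c (f p) * inner ℝ (gaussGrad ε (X p.1 - X p.2)) (H (g p)))
      (ν.prod ν) := by
  refine Integrable.of_bound (by fun_prop) (A * (2 * R / ε * B)) (.of_forall fun p => ?_)
  rw [norm_mul, Real.norm_eq_abs]
  have h1 := (abs_nonneg _).trans (hcA (f p))
  have h2 := norm_gaussGrad_sub_le_two_mul hε hX p.1 p.2
  have h3 := (norm_nonneg _).trans h2
  gcongr
  · exact hcA _
  · exact (norm_inner_le_norm _ _).trans (by gcongr; exact hH _)

/-- Symmetrization: the linear term of the lifting is the pairing with the entropy gradient. -/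
theorem integral_inner_entropyGrad (hε : 0 < ε) (hXm : Measurable X)
    (hX : ∀ z, ‖X z‖ ≤ R) (hHm : Measurable H) {B : ℝ} (hH : ∀ z, ‖H z‖ ≤ B) :
    ∫ z, inner ℝ (entropyGrad ε (ν.map X) (X z)) (H z) ∂ν
      = ∫ z, (gaussConv ε (ν.map X) (X z))⁻¹ *
          ∫ w, inner ℝ (gaussGrad ε (X z - X w)) (H z - H w) ∂ν ∂ν := by
  set c : Z → ℝ := fun z => (gaussConv ε (ν.map X) (X z))⁻¹ with hc
  have hcm : Measurable c := measurable_inv_gaussConv_map hε hXm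
  have hcA := inv_gaussConv_map_le (ν := ν) hε hXm hX
  have iK := integrable_gaussGrad_comp (ν := ν) hε hXm hX
  have icK := integrable_smul_gaussGrad_comp (ν := ν) hε hXm hX hcm hcA
  have hprod := fun f g hf hg => integrable_prod_mul_inner_gaussGrad (ν := ν) hε hXm hX hHm hH hcm
    hcA (f := f) (g := g) hf hg
  have i11 := hprod Prod.fst Prod.fst measurable_fst measurable_fst
  have i12 := hprod Prod.fst Prod.snd measurable_fst measurable_snd
  have i21 := hprod Prod.snd Prod.fst measurable_snd measurable_fst
  have e1 : ∀ z, inner ℝ (entropyGrad ε (ν.map X) (X z)) (H z)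
      = ∫ w, c z * inner ℝ (gaussGrad ε (X z - X w)) (H z) ∂ν
        + ∫ w, c w * inner ℝ (gaussGrad ε (X z - X w)) (H z) ∂ν := by
    intro z
    rw [entropyGrad_map hε hXm, inner_add_left, real_inner_smul_left, integral_const_mul,
      real_inner_comm, ← integral_inner (iK z), real_inner_comm, ← integral_inner (icK z)]
    simp only [real_inner_smul_right, real_inner_comm]
    rfl
  have e2 : ∀ z, (c z * ∫ w, inner ℝ (gaussGrad ε (X z - X w)) (H z - H w) ∂ν)
      = ∫ w, (c z * inner ℝ (gaussGrad ε (X z - X w)) (H z)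
        - c z * inner ℝ (gaussGrad ε (X z - X w)) (H w)) ∂ν := by
    intro z
    simp only [← integral_const_mul, inner_sub_right, mul_sub]
  -- Exchanging `z` and `w` reverses the sign of the odd kernel gradient and moves the weight to the
  -- integration variable, which is the second half of `entropyGrad`.
  have e3 : ∫ z, ∫ w, c z * inner ℝ (gaussGrad ε (X z - X w)) (H w) ∂ν ∂ν
      = - ∫ z, ∫ w, c w * inner ℝ (gaussGrad ε (X z - X w)) (H z) ∂ν ∂ν := by
    rw [integral_integral_swap i12, ← integral_neg]
    refine integral_congr_ae (.of_forall fun z => ?_)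
    simp only [← integral_neg]
    refine integral_congr_ae (.of_forall fun w => ?_)
    simp only
    rw [← neg_sub (X z) (X w), gaussGrad_neg, inner_neg_left, mul_neg]
  simp only [e1]
  change _ = ∫ z, c z * _ ∂ν
  simp only [e2]
  rw [integral_add i11.integral_prod_left i21.integral_prod_left,
    integral_integral_sub i11 i12, e3, sub_neg_eq_add]

end LiftRemainder

/-! ### Maps with all values in the convex set -/

section Carried

variable {d : ℕ} {Z : Type*} [MeasurableSpace Z] {ν : Measure Z} {X : Z → Euc d}
  {C : Set (Euc d)} {U : Euc d → ℝ} {C₁ : ℝ}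

theorem ae_map_mem (hCm : MeasurableSet C) (hXm : Measurable X) (hX : ∀ z, X z ∈ C) :
    ∀ᵐ x ∂(ν.map X), x ∈ C :=
  (ae_map_iff hXm.aemeasurable hCm).2 (.of_forall hX)

theorem aestronglyMeasurable_gradientWithin_comp (hU : HasLipschitzGradientOn C U C₁)
    (hC₁ : 0 ≤ C₁) (hCm : MeasurableSet C) (hXm : Measurable X) (hX : ∀ z, X z ∈ C) :
    AEStronglyMeasurable (fun z => gradientWithin U C (X z)) ν := by
  have hcont : ContinuousOn (gradientWithin U C) C := by
    refine LipschitzOnWith.continuousOn (K := ⟨C₁, hC₁⟩)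
      (LipschitzOnWith.of_dist_le_mul fun x hx y hy => ?_)
    rw [dist_eq_norm, dist_eq_norm]
    exact hU.lipschitz x hx y hy
  have h : ∀ᵐ x ∂(ν.map X), x ∈ C :=
    ae_map_mem hCm hXm hX
  have h2 : AEStronglyMeasurable (gradientWithin U C) (ν.map X) := by
    rw [← Measure.restrict_eq_self_of_ae_mem h]
    exact hcont.aestronglyMeasurable hCm
  exact h2.comp_measurable hXm

end Carried

/-! ### Expansion of the lifting and Lipschitz bound for its gradient -/

section Lifting

variable {d : ℕ} {Z : Type*} [MeasurableSpace Z] {ν : Measure Z} [IsProbabilityMeasure ν]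
  {ε R : ℝ} {X Y : Z → Euc d} {C : Set (Euc d)} {U : Euc d → ℝ} {C₁ : ℝ}

theorem integrable_log_gaussConv_map (hε : 0 < ε) (hXm : Measurable X) (hX : ∀ z, ‖X z‖ ≤ R) :
    Integrable (fun z => Real.log (gaussConv ε (ν.map X) (X z))) ν :=
  have := Measure.isProbabilityMeasure_map (μ := ν) hXm.aemeasurable
  have hb := ae_map_norm_le (ν := ν) hXm hX
  (integrable_log_gaussConv hε hb hb).comp_measurable hXm

theorem measurable_entropyGrad_map (hε : 0 < ε) (hXm : Measurable X) :
    Measurable fun z => entropyGrad ε (ν.map X) (X z) := by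
  have hc := measurable_inv_gaussConv_map (ν := ν) hε hXm
  simp only [entropyGrad_map hε hXm]
  refine (hc.smul (StronglyMeasurable.integral_prod_right' (ν := ν)
    (f := fun p : Z × Z => gaussGrad ε (X p.1 - X p.2)) ?_).measurable).add
    (StronglyMeasurable.integral_prod_right' (ν := ν) (f := fun p : Z × Z =>
      (gaussConv ε (ν.map X) (X p.2))⁻¹ • gaussGrad ε (X p.1 - X p.2)) ?_).measurable
  · exact Measurable.stronglyMeasurable (by fun_prop)
  · exact ((hc.comp measurable_snd).smul (by fun_prop)).stronglyMeasurable

theorem norm_entropyGrad_map_le (hε : 0 < ε) (hXm : Measurable X) (hX : ∀ z, ‖X z‖ ≤ R)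
    (z : Z) : ‖entropyGrad ε (ν.map X) (X z)‖
      ≤ 2 * ((Real.exp (-(2 * R ^ 2 / ε)))⁻¹ * (2 * R / ε)) := by
  have hc := inv_gaussConv_map_le (ν := ν) hε hXm hX
  have hg := norm_gaussGrad_sub_le_two_mul hε hX z
  have hR : 0 ≤ R := (norm_nonneg _).trans (hX z)
  have h1 := norm_integral_le_of_norm_le_const (μ := ν) (.of_forall hg)
  have h2 := norm_integral_le_of_norm_le_const (μ := ν)
    (f := fun w => (gaussConv ε (ν.map X) (X w))⁻¹ • gaussGrad ε (X z - X w))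
    (C := (Real.exp (-(2 * R ^ 2 / ε)))⁻¹ * (2 * R / ε)) (.of_forall fun w => ?_)
  · simp only [probReal_univ, mul_one] at h1 h2
    rw [entropyGrad_map hε hXm, two_mul]
    refine (norm_add_le _ _).trans (add_le_add ?_ h2)
    rw [norm_smul, Real.norm_eq_abs]
    gcongr
    exact hc z
  · rw [norm_smul, Real.norm_eq_abs]
    gcongr
    exacts [hc w, hg w]

/-- The logarithmic term of the lifting has a quadratic remainder. -/
theorem abs_integral_log_gaussConv_map_sub_le (hε : 0 < ε) (hXm : Measurable X)
    (hX : ∀ z, ‖X z‖ ≤ R) (hYm : Measurable Y) (hY : ∀ z, ‖Y z‖ ≤ R) :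
    |∫ z, Real.log (gaussConv ε (ν.map Y) (Y z)) ∂ν - ∫ z, Real.log (gaussConv ε (ν.map X) (X z)) ∂ν
      - ∫ z, inner ℝ (entropyGrad ε (ν.map X) (X z)) (Y z - X z) ∂ν|
      ≤ (((2 * R / ε) ^ 2 / Real.exp (-(2 * R ^ 2 / ε)) ^ 2
        + (Real.exp (-(2 * R ^ 2 / ε)))⁻¹ * (1 / ε)) * 2) * ∫ z, ‖Y z - X z‖ ^ 2 ∂ν := by
  set m := Real.exp (-(2 * R ^ 2 / ε)) with hm
  have hm0 : 0 < m := Real.exp_pos _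
  have hHm : Measurable fun z => Y z - X z := hYm.sub hXm
  have hHB := norm_sub_le_two_mul' hX hY
  have hcm := measurable_inv_gaussConv_map (ν := ν) hε hXm
  have hcA := inv_gaussConv_map_le (ν := ν) hε hXm hX
  have hi := fun n => integrable_norm_sub (ν := ν) hHm hHB n
  have hii := integrable_integral_norm_sub (ν := ν) hHm hHB 2
  have iX := integrable_log_gaussConv_map (ν := ν) hε hXm hX
  have iY := integrable_log_gaussConv_map (ν := ν) hε hYm hY
  have iin : ∀ z, Integrable
      (fun w => inner ℝ (gaussGrad ε (X z - X w)) ((Y z - X z) - (Y w - X w))) ν := by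
    intro z
    refine Integrable.of_bound (by fun_prop) (2 * R / ε * (2 * R + 2 * R)) (.of_forall fun w => ?_)
    have h2 := norm_gaussGrad_sub_le_two_mul hε hX z w
    have h3 := (norm_nonneg _).trans h2
    refine (norm_inner_le_norm _ _).trans ?_
    gcongr
    exact (norm_sub_le _ _).trans (add_le_add (hHB z) (hHB w))
  have iL : Integrable (fun z => (gaussConv ε (ν.map X) (X z))⁻¹ *
      ∫ w, inner ℝ (gaussGrad ε (X z - X w)) ((Y z - X z) - (Y w - X w)) ∂ν) ν := by
    have h1 := integrable_prod_mul_inner_gaussGrad (ν := ν) hε hXm hX hHm hHB hcm hcA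
      measurable_fst measurable_fst
    have h2 := integrable_prod_mul_inner_gaussGrad (ν := ν) hε hXm hX hHm hHB hcm hcA
      measurable_fst measurable_snd
    refine (h1.sub h2).integral_prod_left.congr (.of_forall fun z => ?_)
    simp only [Pi.sub_apply, ← mul_sub, ← inner_sub_right, integral_const_mul]
  rw [integral_inner_entropyGrad hε hXm hX hHm hHB, ← integral_sub iY iX,
    ← integral_sub (iY.sub' iX) iL, ← Real.norm_eq_abs]
  refine (norm_integral_le_of_norm_le (hii.const_mul ((2 * R / ε) ^ 2 / m ^ 2 + m⁻¹ * (1 / ε)))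
    (.of_forall fun z => ?_)).trans ?_
  · set a := gaussConv ε (ν.map X) (X z) with ha
    set b := gaussConv ε (ν.map Y) (Y z) with hb
    set D := ∫ w, ‖(Y z - X z) - (Y w - X w)‖ ∂ν with hD
    set S := ∫ w, ‖(Y z - X z) - (Y w - X w)‖ ^ 2 ∂ν with hS
    set ℓ := ∫ w, inner ℝ (gaussGrad ε (X z - X w)) ((Y z - X z) - (Y w - X w)) ∂ν with hl
    have hDS : D ^ 2 ≤ S := sq_integral_norm_sub_le hHm hHB z
    have hlog := Real.abs_log_sub_log_sub_le hm0 (gaussConv_map_ge (ν := ν) hε hXm hX z)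
      (gaussConv_map_ge (ν := ν) hε hYm hY z)
    have hab := abs_gaussConv_map_sub_le (ν := ν) hε hXm hX hYm hY z
    rw [← ha, ← hb] at hlog hab
    have hlog2 : (b - a) ^ 2 / m ^ 2 ≤ (2 * R / ε) ^ 2 / m ^ 2 * S := by
      calc (b - a) ^ 2 / m ^ 2 ≤ (2 * R / ε * D) ^ 2 / m ^ 2 := by
            rw [← sq_abs (b - a)]; gcongr
        _ = (2 * R / ε) ^ 2 / m ^ 2 * D ^ 2 := by ring
        _ ≤ _ := by gcongr
    have hlin : |b - a - ℓ| ≤ 1 / ε * S := by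
      rw [ha, hb, gaussConv_map hXm, gaussConv_map hYm,
        ← integral_sub (integrable_gaussKernel_comp hε hYm _)
        (integrable_gaussKernel_comp hε hXm _), hl, ← integral_sub
        ((integrable_gaussKernel_comp hε hYm _).sub' (integrable_gaussKernel_comp hε hXm _))
        (iin z), hS, ← integral_const_mul, ← Real.norm_eq_abs]
      refine norm_integral_le_of_norm_le ((hi 2 z).const_mul _) (.of_forall fun w => ?_)
      rw [← norm_sub_sub_comm, sub_sub_sub_comm (Y z)]
      exact abs_gaussKernel_sub_sub_inner_le hε _ _
    -- The error splits into the remainder of the logarithm, quadratic in `b - a`, and the remainder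
    -- of the kernel inside the convolution, weighted by `a⁻¹ ≤ m⁻¹`.
    have e : Real.log b - Real.log a - a⁻¹ * ℓ
        = (Real.log b - Real.log a - a⁻¹ * (b - a)) + a⁻¹ * (b - a - ℓ) := by ring
    rw [Real.norm_eq_abs]
    change |Real.log b - Real.log a - a⁻¹ * ℓ| ≤ _
    rw [e]
    refine (abs_add_le _ _).trans ?_
    rw [abs_mul, add_mul, mul_assoc]
    have := hcA z
    exact add_le_add (hlog.trans hlog2) (mul_le_mul this hlin (abs_nonneg _) (by positivity))
  · rw [integral_const_mul, mul_assoc _ (2 : ℝ)]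
    gcongr
    exact integral_integral_norm_sub_sq_le hHm hHB

/-- The gradient of the canonical first variation at the law of `X`, evaluated along `X`. -/
noncomputable def klGradAlong (C : Set (Euc d)) (U : Euc d → ℝ) (ε : ℝ) (ν : Measure Z) (X : Z → Euc d)
    (z : Z) : Euc d :=
  gradientWithin U C (X z) + entropyGrad ε (ν.map X) (X z)

theorem memLp_klGradAlong (hU : HasLipschitzGradientOn C U C₁)
    (hC₁ : 0 ≤ C₁) (hCm : MeasurableSet C) (hR : C ⊆ Metric.closedBall 0 R) (hε : 0 < ε)
    (hXm : Measurable X) (hX : ∀ z, X z ∈ C) : MemLp (klGradAlong C U ε ν X) 2 ν := by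
  have hXR : ∀ z, ‖X z‖ ≤ R := fun z => by simpa using hR (hX z)
  obtain ⟨B, hB⟩ := hU.exists_norm_gradient_le hC₁ hR
  refine MemLp.of_bound ((aestronglyMeasurable_gradientWithin_comp hU hC₁ hCm hXm hX).add
    (measurable_entropyGrad_map hε hXm).aestronglyMeasurable)
    (B + 2 * ((Real.exp (-(2 * R ^ 2 / ε)))⁻¹ * (2 * R / ε))) (.of_forall fun z => ?_)
  exact (norm_add_le _ _).trans (add_le_add (hB _ (hX z)) (norm_entropyGrad_map_le hε hXm hXR z))

theorem regKL_map (hU : HasLipschitzGradientOn C U C₁)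
    (hC₁ : 0 ≤ C₁) (hC : Convex ℝ C) (hCm : MeasurableSet C) (hR : C ⊆ Metric.closedBall 0 R)
    (hε : 0 < ε) (hXm : Measurable X) (hX : ∀ z, X z ∈ C) :
    regKL C U ε (ν.map X) = ∫ z, U (X z) ∂ν
      + ∫ z, Real.log (gaussConv ε (ν.map X) (X z)) ∂ν := by
  have hXR : ∀ z, ‖X z‖ ≤ R := fun z => by simpa using hR (hX z)
  have := Measure.isProbabilityMeasure_map (μ := ν) hXm.aemeasurable
  have h : ∀ᵐ x ∂(ν.map X), x ∈ C :=
    ae_map_mem hCm hXm hX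
  have hb := ae_map_norm_le (ν := ν) hXm hXR
  have i1 := hU.integrable hC₁ hC hCm hR h
  have i2 := integrable_log_gaussConv hε hb hb
  rw [regKL_eq h, integral_add i1 i2, integral_map hXm.aemeasurable i1.1,
    integral_map hXm.aemeasurable i2.1]

theorem abs_regKL_map_sub_le (hU : HasLipschitzGradientOn C U C₁)
    (hC₁ : 0 ≤ C₁) (hC : Convex ℝ C) (hCm : MeasurableSet C) (hR : C ⊆ Metric.closedBall 0 R)
    (hε : 0 < ε) (hXm : Measurable X) (hX : ∀ z, X z ∈ C) (hYm : Measurable Y)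
    (hY : ∀ z, Y z ∈ C) :
    |regKL C U ε (ν.map Y) - regKL C U ε (ν.map X)
      - ∫ z, inner ℝ (klGradAlong C U ε ν X z) (Y z - X z) ∂ν|
      ≤ (C₁ + ((2 * R / ε) ^ 2 / Real.exp (-(2 * R ^ 2 / ε)) ^ 2
        + (Real.exp (-(2 * R ^ 2 / ε)))⁻¹ * (1 / ε)) * 2) * ∫ z, ‖Y z - X z‖ ^ 2 ∂ν := by
  have hXR : ∀ z, ‖X z‖ ≤ R := fun z => by simpa using hR (hX z)
  have hYR : ∀ z, ‖Y z‖ ≤ R := fun z => by simpa using hR (hY z)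
  obtain ⟨B, hB⟩ := hU.exists_norm_gradient_le hC₁ hR
  have hHB := norm_sub_le_two_mul' hXR hYR
  have iU : ∀ {X : Z → Euc d}, Measurable X → (∀ z, X z ∈ C) →
      Integrable (fun z => U (X z)) ν := by
    intro X hXm hX
    have := Measure.isProbabilityMeasure_map (μ := ν) hXm.aemeasurable
    exact (hU.integrable hC₁ hC hCm hR (ae_map_mem hCm hXm hX)).comp_measurable hXm
  have iG : Integrable (fun z => inner ℝ (gradientWithin U C (X z)) (Y z - X z)) ν := by
    refine Integrable.of_bound ((aestronglyMeasurable_gradientWithin_comp hU hC₁ hCm hXm hX).inner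
      (hYm.sub hXm).aestronglyMeasurable) (B * (2 * R)) (.of_forall fun z => ?_)
    refine (norm_inner_le_norm _ _).trans ?_
    have := (norm_nonneg _).trans (hB _ (hX z))
    exact mul_le_mul (hB _ (hX z)) (hHB z) (norm_nonneg _) this
  have iE : Integrable (fun z => inner ℝ (entropyGrad ε (ν.map X) (X z)) (Y z - X z)) ν := by
    refine Integrable.of_bound ((measurable_entropyGrad_map hε hXm).aestronglyMeasurable.inner
      (hYm.sub hXm).aestronglyMeasurable)
      (2 * ((Real.exp (-(2 * R ^ 2 / ε)))⁻¹ * (2 * R / ε)) * (2 * R)) (.of_forall fun z => ?_)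
    refine (norm_inner_le_norm _ _).trans ?_
    have h1 := norm_entropyGrad_map_le (ν := ν) hε hXm hXR z
    exact mul_le_mul h1 (hHB z) (norm_nonneg _) ((norm_nonneg _).trans h1)
  have iH2 : Integrable (fun z => ‖Y z - X z‖ ^ 2) ν := by
    refine Integrable.of_bound (by fun_prop) ((2 * R) ^ 2) (.of_forall fun z => ?_)
    rw [norm_pow, norm_norm]
    have := hHB z
    gcongr
  have hUr : |∫ z, U (Y z) ∂ν - ∫ z, U (X z) ∂ν
      - ∫ z, inner ℝ (gradientWithin U C (X z)) (Y z - X z) ∂ν|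
      ≤ C₁ * ∫ z, ‖Y z - X z‖ ^ 2 ∂ν := by
    rw [← integral_sub (iU hYm hY) (iU hXm hX), ← integral_sub ((iU hYm hY).sub' (iU hXm hX)) iG,
      ← integral_const_mul, ← Real.norm_eq_abs]
    exact norm_integral_le_of_norm_le (iH2.const_mul _)
      (.of_forall fun z => hU.abs_sub_sub_inner_le hC₁ hC (hX z) (hY z))
  have hLr := abs_integral_log_gaussConv_map_sub_le (ν := ν) hε hXm hXR hYm hYR
  simp only [klGradAlong, inner_add_left]
  rw [integral_add iG iE, regKL_map hU hC₁ hC hCm hR hε hXm hX,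
    regKL_map hU hC₁ hC hCm hR hε hYm hY, add_mul]
  refine le_trans (le_of_eq ?_) ((abs_add_le _ _).trans (add_le_add hUr hLr))
  congr 1
  ring

theorem integral_norm_klGradAlong_sub_sq_le (hU : HasLipschitzGradientOn C U C₁)
    (hC₁ : 0 ≤ C₁) (hR : C ⊆ Metric.closedBall 0 R)
    (hε : 0 < ε) (hXm : Measurable X) (hX : ∀ z, X z ∈ C) (hYm : Measurable Y)
    (hY : ∀ z, Y z ∈ C) :
    ∫ z, ‖klGradAlong C U ε ν Y z - klGradAlong C U ε ν X z‖ ^ 2 ∂ν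
      ≤ (C₁ + 3 / ε * Real.exp (8 * R ^ 2 / ε)) ^ 2 * ∫ z, ‖Y z - X z‖ ^ 2 ∂ν := by
  have hXR : ∀ z, ‖X z‖ ≤ R := fun z => by simpa using hR (hX z)
  have hYR : ∀ z, ‖Y z‖ ≤ R := fun z => by simpa using hR (hY z)
  have hne : Nonempty Z := nonempty_of_isProbabilityMeasure ν
  have hR0 : 0 ≤ R := (norm_nonneg _).trans (hXR hne.some)
  obtain ⟨p, hp⟩ : ∃ p, p = (Real.exp (-(2 * R ^ 2 / ε)))⁻¹ / ε := ⟨_, rfl⟩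
  obtain ⟨q, hq⟩ : ∃ q, q = 2 * R / ε * (2 * R / ε / Real.exp (-(2 * R ^ 2 / ε)) ^ 2) := ⟨_, rfl⟩
  have hp0 : 0 ≤ p := by rw [hp]; positivity
  have hq0 : 0 ≤ q := by rw [hq]; positivity
  refine integral_sq_le_of_le_mean_deviation (hYm.sub hXm) (norm_sub_le_two_mul' hXR hYR)
    (s := 2 * p + q) (t := q) hC₁ (by positivity) hq0 (.of_forall fun _ => norm_nonneg _)
    (.of_forall fun z => ?_) ((three_halves_mul_le_exp hε hp hq).trans' (by linarith))
  have h1 := hU.lipschitz _ (hY z) _ (hX z)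
  have h2 := norm_entropyGrad_map_sub_le (ν := ν) hε hXm hXR hYm hYR z hp hq
  rw [klGradAlong, klGradAlong, add_sub_add_comm, add_assoc]
  exact (norm_add_le _ _).trans (add_le_add h1 h2)

end Lifting

/-! ### Geometry of `L²(ν; C)` in the Hilbert space -/

section HilbertSpace

variable {d : ℕ} {Z : Type*} [MeasurableSpace Z] {ν : Measure Z} {C : Set (Euc d)}

theorem convex_L2On (hC : Convex ℝ C) : Convex ℝ (L2On ν C) := by
  intro X hX Y hY a b ha hb hab
  change ∀ᵐ z ∂ν, (a • X + b • Y : Lp (Euc d) 2 ν) z ∈ C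
  filter_upwards [hX, hY, Lp.coeFn_add (a • X) (b • Y), Lp.coeFn_smul a X, Lp.coeFn_smul b Y]
    with z hx hy h1 h2 h3
  rw [h1, Pi.add_apply, h2, h3]
  exact hC hx hy ha hb hab

/-- `L²(ν; C)` has unique derivatives when `C` is convex with nonempty interior, although
`L²(ν; C)` itself may have empty interior. -/
theorem uniqueDiffWithinAt_L2On [IsFiniteMeasure ν] (hC : Convex ℝ C)
    (hCi : (interior C).Nonempty) {X : Lp (Euc d) 2 ν} (hX : X ∈ L2On ν C) :
    UniqueDiffWithinAt ℝ (L2On ν C) X := by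
  refine ⟨?_, subset_closure hX⟩
  rw [Submodule.dense_iff_topologicalClosure_eq_top, Submodule.topologicalClosure_eq_top_iff,
    Submodule.eq_bot_iff]
  intro g hg
  -- By convexity every `Y - X` is a tangent direction, so `g`, orthogonal to the span of the
  -- tangent cone, annihilates it. It remains to exhibit enough elements `Y`.
  have horth : ∀ Y ∈ L2On ν C, inner ℝ (Y - X) g = 0 := fun Y hY =>
    (Submodule.mem_orthogonal _ g).1 hg _ (Submodule.subset_span
      (mem_tangentConeAt_of_segment_subset ((convex_L2On hC).segment_subset hX hY)))
  obtain ⟨c, hc⟩ := hCi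
  obtain ⟨r, hr, hball⟩ := Metric.isOpen_iff.1 isOpen_interior c hc
  -- An interior point `c` of `C` may be moved by any `v` shorter than `r` on any measurable set
  -- `A`. Comparing `v` with `0` then gives `⟪v, ∫_A g⟫ = 0`.
  have hmem : ∀ {A : Set Z} (hA : MeasurableSet A) (v : Euc d), ‖v‖ < r →
      indicatorConstLp 2 MeasurableSet.univ (measure_ne_top ν _) c
        + indicatorConstLp 2 hA (measure_ne_top ν _) v ∈ L2On ν C := by
    intro A hA v hv
    change ∀ᵐ z ∂ν, _ ∈ C
    filter_upwards [Lp.coeFn_add (indicatorConstLp 2 MeasurableSet.univ (measure_ne_top ν _) c)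
      (indicatorConstLp 2 hA (measure_ne_top ν _) v),
      indicatorConstLp_coeFn (p := 2) (hs := MeasurableSet.univ) (hμs := measure_ne_top ν _)
        (c := c),
      indicatorConstLp_coeFn (p := 2) (hs := hA) (hμs := measure_ne_top ν _) (c := v)]
      with z h1 h2 h3
    rw [h1, Pi.add_apply, h2, h3]
    refine interior_subset (hball ?_)
    rw [Metric.mem_ball, dist_eq_norm]
    by_cases hz : z ∈ A <;> simp [hz, hv, hr]
  have hzero : ∀ {A : Set Z} (hA : MeasurableSet A) (v : Euc d), ‖v‖ < r →
      inner ℝ v (∫ z in A, g z ∂ν) = 0 := by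
    intro A hA v hv
    have h1 := horth _ (hmem hA v hv)
    have h2 := horth _ (hmem hA 0 (by simpa using hr))
    rw [← L2.inner_indicatorConstLp_eq_inner_setIntegral ℝ hA (measure_ne_top ν _)]
    rw [inner_sub_left, inner_add_left] at h1 h2
    have h3 : inner ℝ (indicatorConstLp 2 hA (measure_ne_top ν _) (0 : Euc d)) g = 0 := by
      rw [L2.inner_indicatorConstLp_eq_inner_setIntegral, inner_zero_left]
    linarith
  rw [Lp.eq_zero_iff_ae_eq_zero]
  refine Lp.ae_eq_zero_of_forall_setIntegral_eq_zero g (by simp) (by simp) (fun A _ _ => ?_)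
    fun A hA _ => ?_
  · exact ((Lp.memLp g).integrable (by norm_num)).integrableOn
  · set w := ∫ z in A, g z ∂ν with hw
    by_contra hne
    have hpos : 0 < ‖w‖ := norm_pos_iff.2 hne
    have h := hzero hA ((r / 2 / ‖w‖) • w) (by
      rw [norm_smul, Real.norm_of_nonneg (by positivity), div_mul_cancel₀ _ hpos.ne']
      linarith)
    rw [← hw, real_inner_smul_left, real_inner_self_eq_norm_sq] at h
    have : 0 < r / 2 / ‖w‖ * ‖w‖ ^ 2 := by positivity
    exact this.ne' h

/-- Every element of `L²(ν; C)` has a measurable version with all its values in `C`. -/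
theorem exists_version_of_mem_L2On (hCm : MeasurableSet C) (hCne : C.Nonempty)
    {X : Lp (Euc d) 2 ν} (hX : X ∈ L2On ν C) :
    ∃ X' : Z → Euc d, Measurable X' ∧ (∀ z, X' z ∈ C) ∧ (fun z => X z) =ᵐ[ν] X' := by
  classical
  obtain ⟨c, hc⟩ := hCne
  have hm : Measurable fun z => X z := (Lp.stronglyMeasurable X).measurable
  refine ⟨fun z => if X z ∈ C then X z else c, Measurable.ite (hm hCm) hm measurable_const,
    fun z => ?_, ?_⟩
  · dsimp only
    split_ifs with h
    exacts [h, hc]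
  · filter_upwards [hX] with z hz
    rw [if_pos hz]

end HilbertSpace

/-! ### The Fréchet gradient of the lifting -/

section LiftedGradient

variable {d : ℕ} {Z : Type*} [MeasurableSpace Z] {ν : Measure Z} [IsProbabilityMeasure ν]
  {ε R C₁ : ℝ} {C : Set (Euc d)} {U : Euc d → ℝ}

theorem law_mem_P2 (hCm : MeasurableSet C) (hR : C ⊆ Metric.closedBall 0 R)
    {X : Lp (Euc d) 2 ν} (hX : X ∈ L2On ν C) : law ν X ∈ P2 C := by
  have hm : AEMeasurable (fun z => X z) ν := (Lp.stronglyMeasurable X).measurable.aemeasurable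
  have hp : IsProbabilityMeasure (law ν X) := Measure.isProbabilityMeasure_map hm
  have hc : ∀ᵐ x ∂(law ν X), x ∈ C := (ae_map_iff hm hCm).2 hX
  refine ⟨hp, hc, Integrable.of_bound (by fun_prop) (R ^ 2) ?_⟩
  filter_upwards [ae_norm_le_of_mem_P2 hR hc] with x hx
  rw [norm_pow, norm_norm]
  gcongr

theorem hasGradientWithinAt_lifting (hU : HasLipschitzGradientOn C U C₁)
    (hC₁ : 0 ≤ C₁) (hC : Convex ℝ C) (hCm : MeasurableSet C) (hR : C ⊆ Metric.closedBall 0 R)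
    (hε : 0 < ε) {X g : Lp (Euc d) 2 ν} {X' : Z → Euc d} (hX'm : Measurable X')
    (hX' : ∀ z, X' z ∈ C) (hXX' : (fun z => X z) =ᵐ[ν] X')
    (hg : (fun z => g z) =ᵐ[ν] klGradAlong C U ε ν X') :
    HasGradientWithinAt (lifting ν (regKL C U ε)) g (L2On ν C) X := by
  have hne : Nonempty Z := nonempty_of_isProbabilityMeasure ν
  refine HasGradientWithinAt.of_sq_bound (C₁ + ((2 * R / ε) ^ 2 / Real.exp (-(2 * R ^ 2 / ε)) ^ 2
        + (Real.exp (-(2 * R ^ 2 / ε)))⁻¹ * (1 / ε)) * 2) fun Y hY => ?_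
  obtain ⟨Y', hY'm, hY', hYY'⟩ := exists_version_of_mem_L2On hCm ⟨_, hX' hne.some⟩ hY
  have hsub : (fun z => (Y - X) z) =ᵐ[ν] fun z => Y' z - X' z := by
    filter_upwards [Lp.coeFn_sub Y X, hXX', hYY'] with z h1 h2 h3
    rw [h1, Pi.sub_apply, h2, h3]
  have e1 : inner ℝ g (Y - X) = ∫ z, inner ℝ (klGradAlong C U ε ν X' z) (Y' z - X' z) ∂ν := by
    rw [L2.inner_def]
    refine integral_congr_ae ?_
    filter_upwards [hsub, hg] with z h1 h2
    rw [h1, h2]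
  have e2 : ‖Y - X‖ ^ 2 = ∫ z, ‖Y' z - X' z‖ ^ 2 ∂ν := by
    rw [← real_inner_self_eq_norm_sq, L2.inner_def]
    refine integral_congr_ae ?_
    filter_upwards [hsub] with z h1
    rw [h1, real_inner_self_eq_norm_sq]
  have e3 : law ν X = ν.map X' := Measure.map_congr hXX'
  have e4 : law ν Y = ν.map Y' := Measure.map_congr hYY'
  rw [lifting, lifting, e1, e2, e3, e4]
  exact abs_regKL_map_sub_le hU hC₁ hC hCm hR hε hX'm hX' hY'm hY'

theorem HasGradientWithinAt.unique {F : Type*} [NormedAddCommGroup F] [InnerProductSpace ℝ F]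
    [CompleteSpace F] {f : F → ℝ} {g₁ g₂ x : F} {s : Set F} (hs : UniqueDiffWithinAt ℝ s x)
    (h₁ : HasGradientWithinAt f g₁ s x) (h₂ : HasGradientWithinAt f g₂ s x) : g₁ = g₂ :=
  (InnerProductSpace.toDual ℝ F).injective (hs.eq h₁.hasFDerivWithinAt h₂.hasFDerivWithinAt)

/-- `gradientWithin` is one chosen gradient; unique differentiability of `L²(ν; C)` at `X` forces it
to be the explicit one. -/
theorem liftedGradient_ae_eq (hU : HasLipschitzGradientOn C U C₁)
    (hC₁ : 0 ≤ C₁) (hC : Convex ℝ C) (hCm : MeasurableSet C) (hCi : (interior C).Nonempty)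
    (hR : C ⊆ Metric.closedBall 0 R) (hε : 0 < ε) {X : Lp (Euc d) 2 ν} (hX : X ∈ L2On ν C)
    {X' : Z → Euc d} (hX'm : Measurable X') (hX' : ∀ z, X' z ∈ C)
    (hXX' : (fun z => X z) =ᵐ[ν] X') :
    HasGradientWithinAt (lifting ν (regKL C U ε)) (liftedGradient ν C (regKL C U ε) X)
        (L2On ν C) X ∧
      (fun z => liftedGradient ν C (regKL C U ε) X z) =ᵐ[ν] klGradAlong C U ε ν X' := by
  have hmem := memLp_klGradAlong (ν := ν) hU hC₁ hCm hR hε hX'm hX'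
  have h := hasGradientWithinAt_lifting hU hC₁ hC hCm hR hε hX'm hX' hXX' hmem.coeFn_toLp
  have h2 : HasGradientWithinAt (lifting ν (regKL C U ε)) (liftedGradient ν C (regKL C U ε) X)
      (L2On ν C) X := h.differentiableWithinAt.hasGradientWithinAt
  refine ⟨h2, ?_⟩
  rw [h2.unique (uniqueDiffWithinAt_L2On hC hCi hX) h]
  exact hmem.coeFn_toLp

end LiftedGradient

theorem mainTheorem8 {d : ℕ} {Z : Type*} [TopologicalSpace Z] [PolishSpace Z]
    [MeasurableSpace Z] [BorelSpace Z] (ν : Measure Z) [IsProbabilityMeasure ν] [NullSingletonClass ν]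
    (C : Set (Euc d)) (hCconv : Convex ℝ C) (hCmeas : MeasurableSet C)
    (hCint : (interior C).Nonempty) (R₀ : ℝ) (hR₀ : C ⊆ Metric.closedBall 0 R₀)
    (U : Euc d → ℝ) (C₁ : ℝ) (hC₁ : 0 ≤ C₁) (hU : HasLipschitzGradientOn C U C₁)
    (ε : ℝ) (hε : 0 < ε) :
    -- the first variation exists at every measure and is differentiable on `C`
    (∀ ρ ∈ P2 C,
      (∃ V : Euc d → ℝ, IsFirstVariation C (regKL C U ε) ρ V) ∧
      ∀ V : Euc d → ℝ, IsFirstVariation C (regKL C U ε) ρ V → DifferentiableOn ℝ V C) ∧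
    -- `G[X]` is the unique Fréchet gradient of the lifting, and `G[X] = ∇(δF/δρ)|_{X_# ν} ∘ X`
    (∀ X ∈ L2On ν C,
      HasGradientWithinAt (lifting ν (regKL C U ε)) (liftedGradient ν C (regKL C U ε) X)
        (L2On ν C) X ∧
      (∀ g : Lp (Euc d) 2 ν,
        HasGradientWithinAt (lifting ν (regKL C U ε)) g (L2On ν C) X →
          g = liftedGradient ν C (regKL C U ε) X) ∧
      ∀ V : Euc d → ℝ, IsFirstVariation C (regKL C U ε) (law ν X) V →
        ∀ᵐ z ∂ν, liftedGradient ν C (regKL C U ε) X z = gradientWithin V C (X z)) ∧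
    -- `G` is Lipschitz on `L²(ν; C)`
    (∀ X ∈ L2On ν C, ∀ Y ∈ L2On ν C,
      ∫ z, ‖liftedGradient ν C (regKL C U ε) X z - liftedGradient ν C (regKL C U ε) Y z‖ ^ 2 ∂ν
        ≤ (C₁ + 3 / ε * Real.exp (8 * R₀ ^ 2 / ε)) ^ 2 * ∫ z, ‖X z - Y z‖ ^ 2 ∂ν) := by
  refine ⟨fun ρ hρ => ⟨⟨_, isFirstVariation_klVariation hU hC₁ hCconv hCmeas hR₀ hε hρ⟩,
    fun V hV x hx => (IsFirstVariation.hasGradientWithinAt hU hC₁ hCconv hCmeas hR₀ hε hρ hV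
      hx).differentiableWithinAt⟩, fun X hX => ?_, fun X hX Y hY => ?_⟩
  · obtain ⟨X', hX'm, hX', hXX'⟩ :=
      exists_version_of_mem_L2On hCmeas (hCint.mono interior_subset) hX
    obtain ⟨hG, hGe⟩ := liftedGradient_ae_eq hU hC₁ hCconv hCmeas hCint hR₀ hε hX hX'm hX' hXX'
    refine ⟨hG, fun g hg => hg.unique (uniqueDiffWithinAt_L2On hCconv hCint hX) hG,
      fun V hV => ?_⟩
    filter_upwards [hGe, hXX'] with z h1 h2
    have h := IsFirstVariation.hasGradientWithinAt hU hC₁ hCconv hCmeas hR₀ hε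
      (law_mem_P2 hCmeas hR₀ hX) hV (hX' z)
    have he : law ν X = ν.map X' := Measure.map_congr hXX'
    rw [he] at h
    rw [h1, h2]
    -- A convex set with nonempty interior has unique derivatives at all its points, boundary points
    -- included, so `gradientWithin V C` is the computed gradient.
    exact h.unique (uniqueDiffOn_convex hCconv hCint _ (hX' z))
      h.differentiableWithinAt.hasGradientWithinAt
  · obtain ⟨X', hX'm, hX', hXX'⟩ :=
      exists_version_of_mem_L2On hCmeas (hCint.mono interior_subset) hX
    obtain ⟨Y', hY'm, hY', hYY'⟩ :=
      exists_version_of_mem_L2On hCmeas (hCint.mono interior_subset) hY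
    have hGX := (liftedGradient_ae_eq hU hC₁ hCconv hCmeas hCint hR₀ hε hX hX'm hX' hXX').2
    have hGY := (liftedGradient_ae_eq hU hC₁ hCconv hCmeas hCint hR₀ hε hY hY'm hY' hYY').2
    have e1 : ∫ z, ‖liftedGradient ν C (regKL C U ε) X z
        - liftedGradient ν C (regKL C U ε) Y z‖ ^ 2 ∂ν
        = ∫ z, ‖klGradAlong C U ε ν X' z - klGradAlong C U ε ν Y' z‖ ^ 2 ∂ν := by
      refine integral_congr_ae ?_
      filter_upwards [hGX, hGY] with z h1 h2
      rw [h1, h2]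
    have e2 : ∫ z, ‖X z - Y z‖ ^ 2 ∂ν = ∫ z, ‖X' z - Y' z‖ ^ 2 ∂ν := by
      refine integral_congr_ae ?_
      filter_upwards [hXX', hYY'] with z h1 h2
      rw [h1, h2]
    rw [e1, e2]
    exact integral_norm_klGradAlong_sub_sq_le hU hC₁ hR₀ hε hY'm hY' hX'm hX'
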